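/- Let $1<s\le\infty$, $s'=s/(s-1)$ (with $s'=1$ and $1/s=0$ if $s=\infty$), $k\in(1,2-1/s)$, $\lambda=k/(2-1/s)$ and $\mathbb{R}_+=[0,\infty)$. Let $L^2_{\infty,s}(\mathbb{R}_+)$ be the space of $f\in L_\infty(\mathbb{R}_+)$ that have a locally absolutely continuous derivative $f'$ on $\mathbb{R}_+$ (one-sided at $0$) with $f''\in L_s(\mathbb{R}_+)$. For $f:\mathbb{R}_+\to\mathbb{R}$ and $x\ge 0$, the right-hand sided Marchaud derivative is $$D^k_-f(x)=\frac{1}{\varkappa(k,2)}\int_0^\infty\frac{f(x)-2f(x+t)+f(x+2t)}{t^{1+k}}\,dt,\qquad \varkappa(k,2)=\Gamma(-k)\,(2^k-2).$$ Let $M=\{(a,b)\in(0,1)^2: a\le b\}$. For $(a,b)\in M$ put $\omega(a,b;0)=0$ and $$\omega(a,b;x)=\begin{cases}\dfrac{1-b-(1-b^{1-k})(1-a)}{a(1-b)}, & 0<x\le a,\\[6pt] \dfrac{1-b^{1-k}}{1-b}, & a<x<1,\\[6pt] (1-k)x^{-k}, & x\ge 1,\end{cases}$$ $\tau(a,b;x)=x^{1-k}-\int_0^x\omega(a,b;t)\,dt$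 for $x>0$, $g_{(s')}=|g|^{s'-1}\operatorname{sign}g$, and $$\varphi(a,b;x)=\int_0^a\Bigl(-x+\frac t2\Bigr)\tau_{(s')}(a,b;t)\,dt+\int_0^x(x-t)\,\tau_{(s')}(a,b;t)\,dt,\qquad x\ge0 .$$ (i) The system $$\int_a^1\tau_{(s')}(a,b;t)\,dt=0,\qquad \int_0^1 t\,\tau_{(s')}(a,b;t)\,dt=0$$ has a unique solution $(a_{k,s},b_{k,s})$ in $M$. (ii) For every $f\in L^2_{\infty,s}(\mathbb{R}_+)$ the integral defining $D^k_-f(x)$ converges absolutely for every $x\ge 0$, and $D^k_-f\in L_\infty(\mathbb{R}_+)$. (iii) Let $\varphi_{k,s}=\varphi(a_{k,s},b_{k,s};\cdot)$ and $\Phi_{k,s}=\|\varphi_{k,s}''\|_{L_s(\mathbb{R}_+)}^{-1}\,\varphi_{k,s}$. Then $\Phi_{k,s}\in L^2_{\infty,s}(\mathbb{R}_+)$, $\|\Phi_{k,s}''\|_{L_s(\mathbb{R}_+)}=1$, $\|\Phi_{k,s}\|_{L_\infty(\mathbb{R}_+)}>0$, and for every $f\in L^2_{\infty,s}(\mathbb{R}_+)$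 $$\|D^k_-f\|_{L_\infty(\mathbb{R}_+)}\le\frac{\|D^k_-\Phi_{k,s}\|_{L_\infty(\mathbb{R}_+)}}{\|\Phi_{k,s}\|_{L_\infty(\mathbb{R}_+)}^{1-\lambda}}\;\|f\|_{L_\infty(\mathbb{R}_+)}^{1-\lambda}\,\|f''\|_{L_s(\mathbb{R}_+)}^{\lambda}.$$ The inequality is sharp: the constant in front of $\|f\|_{L_\infty(\mathbb{R}_+)}^{1-\lambda}\|f''\|_{L_s(\mathbb{R}_+)}^{\lambda}$ is the least one for which it holds for all $f\in L^2_{\infty,s}(\mathbb{R}_+)$, and $f=\Phi_{k,s}$ gives equality. -/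

import Mathlib

open MeasureTheory Set
open scoped ENNReal

/-! Functions on the half-line `ℝ₊ = [0, ∞)` are represented by functions `f : ℝ → ℝ` of which only
the values on `Ici 0` are used. -/

noncomputable section

namespace HalfLine

/-- Lebesgue measure on `ℝ₊`. -/
def vol : Measure ℝ := volume.restrict (Ici 0)

/-- The norm of `L_p(ℝ₊)`, as a real number (meaningful for members of `L_p(ℝ₊)`). -/
def norm (p : ℝ≥0∞) (f : ℝ → ℝ) : ℝ := (eLpNorm f p vol).toReal

/-- The first derivative on `ℝ₊` (one-sided at `0`). -/
def d1 (f : ℝ → ℝ) : ℝ → ℝ := derivWithin f (Ici 0)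

/-- The second derivative on `ℝ₊`. -/
def d2 (f : ℝ → ℝ) : ℝ → ℝ := derivWithin (d1 f) (Ici 0)

/-- The space `L²_{∞,s}(ℝ₊)`: bounded functions whose first derivative is locally absolutely
continuous on `[0, ∞)` and whose second derivative lies in `L_s(ℝ₊)`. -/
def space (s : ℝ≥0∞) : Set (ℝ → ℝ) :=
  {f | MemLp f ∞ vol ∧ DifferentiableOn ℝ f (Ici 0) ∧
    (∀ c : ℝ, 0 < c → AbsolutelyContinuousOnInterval (d1 f) 0 c) ∧ MemLp (d2 f) s vol}

/-- The finite difference `(Δⁿ_{-t} f)(x) = ∑ (-1)^m (n choose m) f (x + m t)`. -/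
def diff (n : ℕ) (t : ℝ) (f : ℝ → ℝ) (x : ℝ) : ℝ :=
  ∑ m ∈ Finset.range (n + 1), (-1 : ℝ) ^ m * (n.choose m : ℝ) * f (x + m * t)

/-- The normalising constant `ϰ(k, n)` of the Marchaud derivative. -/
def kappa (k : ℝ) (n : ℕ) : ℝ :=
  Real.Gamma (-k) * ∑ m ∈ Finset.range (n + 1), (-1 : ℝ) ^ m * (n.choose m : ℝ) * (m : ℝ) ^ k

/-- The integrand of the Marchaud derivative of order `k`, with differences of order `⌊k⌋ + 1`,
the least integer exceeding `k`. -/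
def marchaudIntegrand (k : ℝ) (f : ℝ → ℝ) (x t : ℝ) : ℝ :=
  diff (⌊k⌋₊ + 1) t f x / t ^ (1 + k)

/-- The right-hand sided Marchaud fractional derivative `D^k_- f`. -/
def marchaud (k : ℝ) (f : ℝ → ℝ) (x : ℝ) : ℝ :=
  1 / kappa k (⌊k⌋₊ + 1) * ∫ t in Ioi (0 : ℝ), marchaudIntegrand k f x t

/-- `R_θ(x) = x^{θ-1} / Γ(θ)` for `x > 0`, and `0` for `x ≤ 0`. -/
def R (θ x : ℝ) : ℝ := if 0 < x then x ^ (θ - 1) / Real.Gamma θ else 0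

/-- The set `M` of pairs `(a, b) ∈ (0,1)²` with `a ≤ b`. -/
def M : Set (ℝ × ℝ) := {p | p.1 ∈ Ioo (0 : ℝ) 1 ∧ p.2 ∈ Ioo (0 : ℝ) 1 ∧ p.1 ≤ p.2}

/-- The function `ω(a, b; ·)` on `ℝ₊`. -/
def omega (k a b x : ℝ) : ℝ :=
  if x ≤ 0 then 0
  else if x ≤ a then a⁻¹ * (1 - b)⁻¹ * (1 - b - (1 - b ^ (1 - k)) * (1 - a))
  else if x < 1 then (1 - b)⁻¹ * (1 - b ^ (1 - k))
  else (1 - k) * x ^ (-k)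

/-- The first integral `ω^{[1]}(a, b; x) = ∫_0^x ω(a, b; t) dt`. -/
def omegaInt (k a b x : ℝ) : ℝ := ∫ t in (0 : ℝ)..x, omega k a b t

/-- The function `τ(a, b; ·) = Γ(2-k) R_{2-k} - ω^{[1]}(a, b; ·)`. -/
def tau (k a b x : ℝ) : ℝ := Real.Gamma (2 - k) * R (2 - k) x - omegaInt k a b x

/-- The conjugate exponent `s' = s / (s - 1) = 1 / (1 - 1/s)`, equal to `1` for `s = ∞`. -/
def conjExp (s : ℝ≥0∞) : ℝ := 1 / (1 - 1 / s.toReal)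

/-- `τ_{(s')} = |τ|^{s'-1} sign τ`. -/
def tauPow (s : ℝ≥0∞) (k a b x : ℝ) : ℝ :=
  |tau k a b x| ^ (conjExp s - 1) * Real.sign (tau k a b x)

/-- The function `φ(a, b; ·)`. -/
def phi (s : ℝ≥0∞) (k a b x : ℝ) : ℝ :=
  (∫ t in (0 : ℝ)..a, (-x + t / 2) * tauPow s k a b t) +
    ∫ t in (0 : ℝ)..x, (x - t) * tauPow s k a b t

/-- `(a, b) ∈ M` solves the system `∫_a^1 τ_{(s')} dt = 0`, `∫_0^1 t τ_{(s')} dt = 0`. -/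
def IsSolution (s : ℝ≥0∞) (k : ℝ) (p : ℝ × ℝ) : Prop :=
  p ∈ M ∧ (∫ t in p.1..1, tauPow s k p.1 p.2 t) = 0 ∧
    (∫ t in (0 : ℝ)..1, t * tauPow s k p.1 p.2 t) = 0

/-- `Φ = ‖φ''‖_{L_s(ℝ₊)}⁻¹ φ`. -/
def Phi (s : ℝ≥0∞) (k a b x : ℝ) : ℝ := (norm s (d2 (phi s k a b)))⁻¹ * phi s k a b x

end HalfLine

end

/-! Translation and dilation reduce everything to the origin. With `g t = f (x + h * t)`, the
quantity `Γ(-k) h^k D^k f(x)` is the integral over `(0, ∞)` of the Taylor remainder `g t - g 0 - g'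
0 * t` against `t^(-1-k)`. On `(0, 1)` two integrations by parts turn this into an integral of
`t^(1-k) * g''`. From `t^(1-k)` one subtracts a tent: linear on `[0, a]` from the value 0, then
linear with slope `-c` on `[a, 1]` down to the value 1. Integrated against `g''`, the tent gives
values of `g` at `0, a, 1` and the term `g' 1`. All first derivatives cancel in the end, and what
remains (`Triple.representation`) is `∫ τ g''` plus a combination of `g 0`, `g a`, `g 1` and the
mean of `g` over `(1, ∞)`, with weights of signs `+, -, +, +`. Hölder then gives an additive
inequality with weights `2(1+c)/a` on the sup norm and `‖τ‖_{s'}` on the norm of `g''`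
(`Triple.additive_inequality`).

Equality needs `g'' = τ_{(s')}` on `(0, 1)` up to a factor and `g = N, -N, N` at `0`, at `a` and on
`[1, ∞)`, where `N` is the sup norm. The function `φ` is built with `φ'' = τ_{(s')}`, `φ' a = 0` and
`φ a = -φ 0`; the two equations of the system say `φ' 1 = 0` and `φ 1 = φ 0`. Taking for `-c` the
slope of the chord of `x^(1-k)` over `[b, 1]` makes `τ` positive on `(0, b)` and negative on `(b,
1)`, by strict convexity. Hence `φ` falls on `[0, a]`, rises afterwards, and `|φ| ≤ φ 0`
(`Extremal.abs_phi_le`).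

To solve the system, write `F` and `H` for its two integrals. `F` increases with `b` and decreases
with `a`, so for each `a` it vanishes at one `b = β a`, and `β` is continuous and increasing. Along
this curve `H` increases, is negative at `a = 0` and positive near `a = 1`, which gives exactly one
solution.

Finally the additive inequality holds for every dilation `h`. The `h` that matches the ratio of the
norms of `f` to that of `Φ` gives the multiplicative inequality (`multiplicative_of_additive`), and
testing on `Φ` gives sharpness. -/

namespace HalfLine

open Filter Topology

/-! ### Functions on the half-line with an absolutely continuous derivative -/

section

/-- `g` is bounded by `N` on the half-line, has derivative `g1` there, and `g1` is a primitive of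
`g2`, whose `L_s` norm is at most `S`. -/
structure Triple (s : ℝ≥0∞) (N S : ℝ) (g g1 g2 : ℝ → ℝ) : Prop where
  bdd : ∀ t, 0 ≤ t → |g t| ≤ N
  hasDeriv : ∀ t, 0 ≤ t → HasDerivWithinAt g (g1 t) (Ici 0) t
  prim : ∀ t, 0 ≤ t → g1 t = g1 0 + ∫ u in (0 : ℝ)..t, g2 u
  memLp : MemLp g2 s vol
  norm_le : norm s g2 ≤ S

/-- For `s = ∞` both sides vanish, because `∞.toReal = 0` and `1 / 0 = 0`. Thus the real number `1 /
s.toReal` stands for `1/s` in all exponents, endpoint included. -/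
theorem inv_toReal_eq {s : ℝ≥0∞} (hs : 1 < s) : s⁻¹ = ENNReal.ofReal (1 / s.toReal) := by
  rcases eq_or_ne s ∞ with rfl | h
  · simp
  · have : 0 < s.toReal := ENNReal.toReal_pos (by positivity) h
    rw [one_div, ENNReal.ofReal_inv_of_pos this, ENNReal.ofReal_toReal h]

theorem one_div_toReal_nonneg (s : ℝ≥0∞) : 0 ≤ 1 / s.toReal := by positivity

theorem one_div_toReal_lt_one {s : ℝ≥0∞} (hs : 1 < s) : 1 / s.toReal < 1 := by
  rcases eq_or_ne s ∞ with rfl | h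
  · simp
  · have : 1 < s.toReal := by
      rw [← ENNReal.toReal_one]
      exact (ENNReal.toReal_lt_toReal (by simp) h).2 hs
    rw [div_lt_one (by linarith)]; exact this

theorem holderConjugate_conjExp {s : ℝ≥0∞} (hs : 1 < s) :
    ENNReal.HolderConjugate (ENNReal.ofReal (conjExp s)) s := by
  have h1 := one_div_toReal_lt_one hs
  have h0 := one_div_toReal_nonneg s
  refine ⟨?_⟩
  rw [inv_toReal_eq hs, conjExp, ← ENNReal.ofReal_inv_of_pos (by
    apply one_div_pos.2; linarith), ← ENNReal.ofReal_add (by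
      rw [one_div, inv_inv]; linarith) h0]
  simp

theorem memLp_restrict_Ioc {s : ℝ≥0∞} {g2 : ℝ → ℝ} (h : MemLp g2 s vol) {a b : ℝ} (ha : 0 ≤ a) :
    MemLp g2 s (volume.restrict (Ioc a b)) :=
  h.mono_measure (Measure.restrict_mono (fun _ hx => (ha.trans hx.1.le : (0 : ℝ) ≤ _)) le_rfl)

theorem eLpNorm_restrict_Ioc_le {s : ℝ≥0∞} {g2 : ℝ → ℝ} (h : MemLp g2 s vol) {a b S : ℝ}
    (ha : 0 ≤ a) (hS : norm s g2 ≤ S) :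
    eLpNorm g2 s (volume.restrict (Ioc a b)) ≤ ENNReal.ofReal S := by
  refine (eLpNorm_mono_measure g2 (Measure.restrict_mono (s' := Ici 0)
    (fun _ hx => (ha.trans hx.1.le : (0 : ℝ) ≤ _)) le_rfl)).trans ?_
  exact ENNReal.le_ofReal_iff_toReal_le h.2.ne (le_trans (by unfold norm; positivity) hS) |>.2 hS

theorem intervalIntegrable_of_memLp {s : ℝ≥0∞} (hs : 1 < s) {g2 : ℝ → ℝ} (h : MemLp g2 s vol)
    {a b : ℝ} (ha : 0 ≤ a) (hab : a ≤ b) : IntervalIntegrable g2 volume a b := by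
  rw [intervalIntegrable_iff_integrableOn_Ioc_of_le hab]
  exact (memLp_restrict_Ioc h ha).integrable hs.le

/-- Hölder's inequality for an integral over a bounded interval. -/
theorem abs_integral_le_rpow {s : ℝ≥0∞} (hs : 1 < s) {g2 : ℝ → ℝ} (h : MemLp g2 s vol)
    {a b S : ℝ} (ha : 0 ≤ a) (hab : a ≤ b) (hS : norm s g2 ≤ S) :
    |∫ u in a..b, g2 u| ≤ S * (b - a) ^ (1 - 1 / s.toReal) := by
  have hS0 : 0 ≤ S := le_trans (by unfold norm; positivity) hS
  rw [intervalIntegral.integral_of_le hab, ← Real.norm_eq_abs, ← ENNReal.ofReal_le_ofReal_iff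
    (by have := Real.rpow_nonneg (sub_nonneg.2 hab) (1 - 1 / s.toReal); positivity),
    ofReal_norm]
  refine (enorm_integral_le_lintegral_enorm _).trans ?_
  rw [← eLpNorm_one_eq_lintegral_enorm]
  refine (eLpNorm_le_eLpNorm_mul_rpow_measure_univ hs.le (memLp_restrict_Ioc h ha).1).trans ?_
  rw [ENNReal.ofReal_mul hS0]
  refine mul_le_mul' (eLpNorm_restrict_Ioc_le h ha hS) ?_
  rw [Measure.restrict_apply_univ, Real.volume_Ioc, ENNReal.ofReal_rpow_of_nonneg (by linarith)
    (by have := one_div_toReal_lt_one hs; simp at this ⊢; linarith)]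
  simp

variable {s : ℝ≥0∞} {N S : ℝ} {g g1 g2 : ℝ → ℝ}

theorem Triple.norm_nonneg (h : Triple s N S g g1 g2) : 0 ≤ S :=
  le_trans (by unfold norm; positivity) h.norm_le

theorem Triple.continuousOn (h : Triple s N S g g1 g2) : ContinuousOn g (Ici 0) :=
  fun t ht => (h.hasDeriv t ht).continuousWithinAt

theorem absolutelyContinuous_congr {u v : ℝ → ℝ} {a b : ℝ}
    (hu : AbsolutelyContinuousOnInterval u a b) (huv : EqOn u v (uIcc a b)) :
    AbsolutelyContinuousOnInterval v a b := by
  rw [absolutelyContinuousOnInterval_iff] at hu ⊢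
  intro ε hε
  obtain ⟨δ, hδ, H⟩ := hu ε hε
  refine ⟨δ, hδ, fun E hE hd => ?_⟩
  convert H E hE hd using 1
  refine Finset.sum_congr rfl fun i hi => ?_
  rw [huv (hE.1 i hi).1, huv (hE.1 i hi).2]

theorem Triple.absolutelyContinuous (hs : 1 < s) (h : Triple s N S g g1 g2) {a b : ℝ}
    (ha : 0 ≤ a) (hab : a ≤ b) : AbsolutelyContinuousOnInterval g1 a b := by
  have hi := intervalIntegrable_of_memLp hs h.memLp le_rfl (ha.trans hab)
  have := (hi.absolutelyContinuousOnInterval_intervalIntegral (c := 0) (by simp)).mono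
    (c := a) (d := b) (by rw [uIcc_of_le hab, uIcc_of_le (ha.trans hab)]; exact Icc_subset_Icc_left ha)
  have h2 : AbsolutelyContinuousOnInterval (fun _ : ℝ => g1 0) a b :=
    contDiffOn_const.absolutelyContinuousOnInterval
  refine absolutelyContinuous_congr (h2.fun_add this) fun t ht => ?_
  rw [uIcc_of_le hab] at ht
  exact (h.prim t (ha.trans ht.1)).symm

theorem Triple.ae_hasDerivAt (hs : 1 < s) (h : Triple s N S g g1 g2) {a b : ℝ}
    (ha : 0 ≤ a) (hab : a ≤ b) : ∀ᵐ x, x ∈ Ioo a b → HasDerivAt g1 (g2 x) x := by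
  have hi := intervalIntegrable_of_memLp hs h.memLp le_rfl (ha.trans hab)
  filter_upwards [hi.ae_hasDerivAt_integral] with x hx hxab
  have := (hx (by rw [uIcc_of_le (ha.trans hab)]; exact ⟨ha.trans hxab.1.le, hxab.2.le⟩) 0
    (by simp)).const_add (g1 0)
  refine this.congr_of_eventuallyEq ?_
  filter_upwards [Ioi_mem_nhds (ha.trans_lt hxab.1)] with y hy
  exact h.prim y (le_of_lt hy)

theorem Triple.integral_mul (hs : 1 < s) (h : Triple s N S g g1 g2) {a b : ℝ}
    (ha : 0 ≤ a) (hab : a ≤ b) {u : ℝ → ℝ} (hu : ContDiffOn ℝ 1 u (Icc a b)) :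
    ∫ x in a..b, u x * g2 x = u b * g1 b - u a * g1 a - ∫ x in a..b, deriv u x * g1 x := by
  have hu' : AbsolutelyContinuousOnInterval u a b :=
    ContDiffOn.absolutelyContinuousOnInterval (by rwa [uIcc_of_le hab])
  rw [← hu'.integral_mul_deriv_eq_deriv_mul (h.absolutelyContinuous hs ha hab)]
  apply intervalIntegral.integral_congr_ae
  filter_upwards [h.ae_hasDerivAt hs ha hab, Measure.ae_ne volume b] with x hx hb hxm
  rw [uIoc_of_le hab] at hxm
  rw [(hx ⟨hxm.1, lt_of_le_of_ne hxm.2 hb⟩).deriv]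

theorem Triple.continuousOn_deriv (hs : 1 < s) (h : Triple s N S g g1 g2) :
    ContinuousOn g1 (Ici 0) := by
  intro t ht
  have ht : (0 : ℝ) ≤ t := ht
  have := (h.absolutelyContinuous hs le_rfl (by linarith : (0 : ℝ) ≤ t + 1)).continuousOn
  rw [uIcc_of_le (by linarith)] at this
  refine (this t ⟨ht, by linarith⟩).mono_of_mem_nhdsWithin ?_
  exact inter_mem_nhdsWithin _ (Iic_mem_nhds (by linarith))

theorem Triple.hasDerivAt (h : Triple s N S g g1 g2) {t : ℝ} (ht : 0 < t) :
    HasDerivAt g (g1 t) t := (h.hasDeriv t ht.le).hasDerivAt (Ici_mem_nhds ht)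

theorem Triple.abs_deriv_sub_le (hs : 1 < s) (h : Triple s N S g g1 g2) {t : ℝ} (ht : 0 ≤ t) :
    |g1 t - g1 0| ≤ S * t ^ (1 - 1 / s.toReal) := by
  rw [h.prim t ht]
  simpa using abs_integral_le_rpow hs h.memLp le_rfl ht h.norm_le

/-- Mean value inequality for `u ↦ g u - g1 0 * u`, whose derivative is bounded on `[0, t]` by
Hölder. The exponent `2 - 1/s` exceeds `k` in the applications, which yields convergence at the
origin. -/
theorem Triple.abs_remainder_le (hs : 1 < s) (h : Triple s N S g g1 g2) {t : ℝ} (ht : 0 ≤ t) :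
    |g t - g 0 - g1 0 * t| ≤ S * t ^ (2 - 1 / s.toReal) := by
  have hσ := one_div_toReal_lt_one hs
  have key := (convex_Icc (0 : ℝ) t).norm_image_sub_le_of_norm_hasDerivWithin_le
    (f := fun u => g u - g1 0 * u) (f' := fun u => g1 u - g1 0 * 1)
    (C := S * t ^ (1 - 1 / s.toReal)) (x := 0) (y := t)
    (fun u hu => ((h.hasDeriv u hu.1).mono Icc_subset_Ici_self).sub
      ((hasDerivWithinAt_id _ _).const_mul _))
    (fun u hu => by
      rw [mul_one, Real.norm_eq_abs]
      refine (h.abs_deriv_sub_le hs hu.1).trans ?_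
      have := h.norm_nonneg
      exact mul_le_mul_of_nonneg_left (Real.rpow_le_rpow hu.1 hu.2 (by linarith)) this) ⟨le_rfl, ht⟩ ⟨ht, le_rfl⟩
  have e : g t - g1 0 * t - (g 0 - g1 0 * 0) = g t - g 0 - g1 0 * t := by ring
  rw [e, Real.norm_eq_abs, sub_zero, Real.norm_of_nonneg ht, mul_assoc] at key
  convert key using 2
  rcases ht.eq_or_lt with rfl | ht
  · rw [Real.zero_rpow (by linarith), Real.zero_rpow (by linarith)]; simp
  · rw [← Real.rpow_add_one ht.ne']; congr 1; ring

end

/-! ### The Taylor remainder and second differences -/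

section

variable {s : ℝ≥0∞} {N S k : ℝ} {g g1 g2 : ℝ → ℝ}

theorem Triple.bound_nonneg (h : Triple s N S g g1 g2) : 0 ≤ N :=
  (abs_nonneg _).trans (h.bdd 0 le_rfl)

theorem integrableOn_Ioi_of_abs_le {F : ℝ → ℝ} {A B α β : ℝ} (hF : ContinuousOn F (Ioi 0))
    (hα : -1 < α) (hβ : β < -1) (h0 : ∀ t ∈ Ioc (0 : ℝ) 1, |F t| ≤ A * t ^ α)
    (h1 : ∀ t ∈ Ioi (1 : ℝ), |F t| ≤ B * t ^ β) : IntegrableOn F (Ioi 0) := by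
  rw [← Ioc_union_Ioi_eq_Ioi (zero_le_one' ℝ)]
  refine IntegrableOn.union ?_ ?_
  · have hi := (intervalIntegral.intervalIntegrable_rpow' (a := 0) (b := 1) hα).const_mul A
    rw [intervalIntegrable_iff_integrableOn_Ioc_of_le zero_le_one] at hi
    exact Integrable.mono' hi ((hF.mono Ioc_subset_Ioi_self).aestronglyMeasurable measurableSet_Ioc)
      ((ae_restrict_iff' measurableSet_Ioc).2 (Eventually.of_forall h0))
  · have hi := (integrableOn_Ioi_rpow_of_lt hβ one_pos).const_mul B
    exact Integrable.mono' hi ((hF.mono (Ioi_subset_Ioi zero_le_one)).aestronglyMeasurable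
      measurableSet_Ioi) ((ae_restrict_iff' measurableSet_Ioi).2 (Eventually.of_forall h1))

theorem Triple.continuousOn_remainder (h : Triple s N S g g1 g2) :
    ContinuousOn (fun t => (g t - g 0 - g1 0 * t) * t ^ (-1 - k)) (Ioi 0) := by
  refine ContinuousOn.mul ?_ ?_
  · exact ((h.continuousOn.mono Ioi_subset_Ici_self).sub continuousOn_const).sub
      (continuousOn_const.mul continuousOn_id)
  · exact fun t ht => (Real.continuousAt_rpow_const t _ (Or.inl (ne_of_gt ht))).continuousWithinAt

/-- Near 0 the remainder is `O(t^(2 - 1/s))` and `k < 2 - 1/s`; at infinity it grows at most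
linearly and `k > 1`. -/
theorem Triple.integrableOn_remainder (hs : 1 < s) (hk : 1 < k) (hks : k < 2 - 1 / s.toReal)
    (h : Triple s N S g g1 g2) :
    IntegrableOn (fun t => (g t - g 0 - g1 0 * t) * t ^ (-1 - k)) (Ioi 0) := by
  refine integrableOn_Ioi_of_abs_le (A := S) (B := 2 * N + |g1 0|)
    (α := 2 - 1 / s.toReal + (-1 - k)) (β := -k)
    h.continuousOn_remainder (by linarith) (by linarith) (fun t ht => ?_) (fun t ht => ?_)
  · rw [abs_mul, Real.rpow_add ht.1, ← mul_assoc, Real.abs_rpow_of_nonneg ht.1.le,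
      abs_of_pos ht.1]
    exact mul_le_mul_of_nonneg_right (h.abs_remainder_le hs ht.1.le) (Real.rpow_nonneg ht.1.le _)
  · have ht : 1 < t := ht
    have ht0 : 0 < t := by linarith
    have e : t ^ (-k) = t * t ^ (-1 - k) := by
      rw [mul_comm, ← Real.rpow_add_one ht0.ne']; congr 1; ring
    rw [abs_mul, Real.abs_rpow_of_nonneg ht0.le, abs_of_pos ht0, e, ← mul_assoc]
    refine mul_le_mul_of_nonneg_right ?_ (Real.rpow_nonneg ht0.le _)
    have hN := h.bound_nonneg
    calc |g t - g 0 - g1 0 * t| ≤ |g t - g 0| + |g1 0 * t| := abs_sub _ _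
      _ ≤ (|g t| + |g 0|) + |g1 0| * t := by
        rw [abs_mul, abs_of_pos ht0]; gcongr; exact abs_sub _ _
      _ ≤ (N + N) * t + |g1 0| * t := by
        have := h.bdd t ht0.le
        have := h.bdd 0 le_rfl
        nlinarith
      _ = _ := by ring

/-- The integral of the second differences through the Taylor remainder at the origin. -/
theorem Triple.second_difference (hs : 1 < s) (hk : 1 < k) (hks : k < 2 - 1 / s.toReal)
    (h : Triple s N S g g1 g2) :
    IntegrableOn (fun t => (g 0 - 2 * g t + g (2 * t)) / t ^ (1 + k)) (Ioi 0) ∧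
    ∫ t in Ioi (0 : ℝ), (g 0 - 2 * g t + g (2 * t)) / t ^ (1 + k) =
      (2 ^ k - 2) * ∫ t in Ioi (0 : ℝ), (g t - g 0 - g1 0 * t) * t ^ (-1 - k) := by
  set F : ℝ → ℝ := fun t => (g t - g 0 - g1 0 * t) * t ^ (-1 - k) with hF
  have hi : IntegrableOn F (Ioi 0) := h.integrableOn_remainder hs hk hks
  have hi2 : IntegrableOn (fun t => F (2 * t)) (Ioi 0) := by
    have := (integrableOn_Ioi_comp_mul_left_iff F 0 (two_pos (α := ℝ))).2 (by simpa using hi)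
    exact this
  -- The second difference is `R(2t) - 2 R(t)` for the Taylor remainder `R`, since the linear part
  -- cancels. The substitution `2t → t` then produces the factor `2^k - 2`.
  have e : EqOn (fun t => 2 ^ (1 + k) * F (2 * t) - 2 * F t)
      (fun t => (g 0 - 2 * g t + g (2 * t)) / t ^ (1 + k)) (Ioi 0) := by
    intro t ht
    have ht : 0 < t := ht
    simp only [hF]
    rw [Real.mul_rpow two_pos.le ht.le, show (-1 - k) = -(1 + k) by ring, Real.rpow_neg two_pos.le,
      Real.rpow_neg ht.le]
    have h1 : (2 : ℝ) ^ (1 + k) ≠ 0 := by positivity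
    have h2 : t ^ (1 + k) ≠ 0 := by positivity
    field_simp
    ring
  have hd : IntegrableOn (fun t => 2 ^ (1 + k) * F (2 * t) - 2 * F t) (Ioi 0) :=
    (hi2.const_mul _).sub (hi.const_mul _)
  refine ⟨hd.congr_fun e measurableSet_Ioi, ?_⟩
  rw [← setIntegral_congr_fun measurableSet_Ioi e, integral_sub (hi2.const_mul _) (hi.const_mul _),
    integral_const_mul, integral_const_mul, integral_comp_mul_left_Ioi F 0 two_pos, mul_zero,
    smul_eq_mul, Real.rpow_add two_pos, Real.rpow_one]
  ring

end

/-! ### Integration by parts against the power kernel -/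

section

variable {s : ℝ≥0∞} {N S k : ℝ} {g g1 g2 : ℝ → ℝ}

theorem rpow_mul_conjExp_gt (hs : 1 < s) (hk : 1 < k) (hks : k < 2 - 1 / s.toReal) :
    -1 < (1 - k) * conjExp s := by
  have h1 := one_div_toReal_lt_one hs
  rw [conjExp, mul_one_div, lt_div_iff₀ (by linarith)]
  linarith

theorem conjExp_ge_one (hs : 1 < s) : 1 ≤ conjExp s := by
  have h1 := one_div_toReal_lt_one hs
  have h0 := one_div_toReal_nonneg s
  rw [conjExp, le_div_iff₀ (by linarith)]
  linarith

theorem memLp_conjExp_of_abs_le (hs : 1 < s) (hk : 1 < k) (hks : k < 2 - 1 / s.toReal)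
    {u : ℝ → ℝ} {C : ℝ} (hm : AEStronglyMeasurable u (volume.restrict (Ioc 0 1)))
    (hu : ∀ t ∈ Ioc (0 : ℝ) 1, |u t| ≤ C * t ^ (1 - k)) :
    MemLp u (ENNReal.ofReal (conjExp s)) (volume.restrict (Ioc 0 1)) := by
  have hp := conjExp_ge_one hs
  have hC : 0 ≤ C := by
    have := (abs_nonneg _).trans (hu 1 ⟨one_pos, le_rfl⟩)
    simpa using this
  rw [← integrable_norm_rpow_iff hm (by simp; linarith) ENNReal.ofReal_ne_top,
    ENNReal.toReal_ofReal (by linarith)]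
  have hi := (intervalIntegral.intervalIntegrable_rpow' (a := 0) (b := 1)
    (rpow_mul_conjExp_gt hs hk hks)).const_mul (C ^ conjExp s)
  rw [intervalIntegrable_iff_integrableOn_Ioc_of_le zero_le_one] at hi
  refine Integrable.mono' hi (hm.norm.aemeasurable.pow_const _).aestronglyMeasurable
    ((ae_restrict_iff' measurableSet_Ioc).2 (Eventually.of_forall fun t ht => ?_))
  rw [Real.norm_of_nonneg (by positivity), Real.rpow_mul ht.1.le,
    ← Real.mul_rpow hC (Real.rpow_nonneg ht.1.le _)]
  exact Real.rpow_le_rpow (by positivity) (hu t ht) (by linarith)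

theorem measurable_rpow_const' (r : ℝ) : Measurable fun t : ℝ => t ^ r := by fun_prop

theorem Triple.integrable_mul (hs : 1 < s) (h : Triple s N S g g1 g2) {u : ℝ → ℝ}
    (hu : MemLp u (ENNReal.ofReal (conjExp s)) (volume.restrict (Ioc 0 1))) :
    IntervalIntegrable (fun t => u t * g2 t) volume 0 1 := by
  rw [intervalIntegrable_iff_integrableOn_Ioc_of_le zero_le_one]
  have := holderConjugate_conjExp hs
  exact hu.integrable_mul (memLp_restrict_Ioc h.memLp le_rfl)

theorem Triple.absolutelyContinuous_fun (hs : 1 < s) (h : Triple s N S g g1 g2) {a b : ℝ}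
    (ha : 0 ≤ a) (hab : a ≤ b) : AbsolutelyContinuousOnInterval g a b := by
  have hc : ContinuousOn g1 (Icc a b) :=
    (h.continuousOn_deriv hs).mono fun x hx => ha.trans hx.1
  obtain ⟨C, hC⟩ := isCompact_Icc.exists_bound_of_continuousOn hc
  have hl := (convex_Icc a b).lipschitzOnWith_of_nnnorm_hasDerivWithin_le (f := g) (f' := g1)
    (C := C.toNNReal) (fun x hx => (h.hasDeriv x (ha.trans hx.1)).mono fun y hy => ha.trans hy.1)
    (fun x hx => by
      rw [← NNReal.coe_le_coe, coe_nnnorm, Real.coe_toNNReal']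
      exact (hC x hx).trans (le_max_left _ _))
  rw [← uIcc_of_le hab] at hl
  exact hl.absolutelyContinuousOnInterval

theorem absolutelyContinuous_rpow {r a b : ℝ} (ha : 0 < a) (hab : a ≤ b) :
    AbsolutelyContinuousOnInterval (fun t : ℝ => t ^ r) a b := by
  refine ContDiffOn.absolutelyContinuousOnInterval fun t ht => ?_
  rw [uIcc_of_le hab] at ht
  exact (Real.contDiffAt_rpow_const_of_ne (ha.trans_le ht.1).ne').contDiffWithinAt

/-- Integration by parts against the power kernel on `(0, 1)`. -/
theorem Triple.integral_rpow_mul (hs : 1 < s) (hk : 1 < k) (hks : k < 2 - 1 / s.toReal)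
    (h : Triple s N S g g1 g2) :
    ∫ t in (0 : ℝ)..1, t ^ (1 - k) * g2 t = (g1 1 - g1 0) + (k - 1) * (g 1 - g 0 - g1 0) +
      k * (k - 1) * ∫ t in (0 : ℝ)..1, (g t - g 0 - g1 0 * t) * t ^ (-1 - k) := by
  have hσ := one_div_toReal_lt_one hs
  have hi1 : IntervalIntegrable (fun t => t ^ (1 - k) * g2 t) volume 0 1 :=
    h.integrable_mul hs (memLp_conjExp_of_abs_le hs hk hks
      (measurable_rpow_const' _).aestronglyMeasurable (C := 1) fun t ht => by
        rw [one_mul, abs_of_nonneg (Real.rpow_nonneg ht.1.le _)])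
  have hi2 : IntervalIntegrable (fun t => (g t - g 0 - g1 0 * t) * t ^ (-1 - k)) volume 0 1 := by
    rw [intervalIntegrable_iff_integrableOn_Ioc_of_le zero_le_one]
    exact (h.integrableOn_remainder hs hk hks).mono_set Ioc_subset_Ioi_self
  -- `P` is a primitive of `F` below: on differentiation the two terms with `t^(-k) * (g1 t - g1 0)`
  -- cancel.
  set P : ℝ → ℝ := fun t => t ^ (1 - k) * (g1 t - g1 0) +
    (k - 1) * (t ^ (-k) * (g t - g 0 - g1 0 * t)) with hP
  set F : ℝ → ℝ := fun t => t ^ (1 - k) * g2 t -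
    k * (k - 1) * ((g t - g 0 - g1 0 * t) * t ^ (-1 - k)) with hF
  have hFi : IntervalIntegrable F volume 0 1 := hi1.sub (hi2.const_mul _)
  -- The powers are singular at 0, so the identity is proved on `[ε, 1]` and `ε` is sent to 0.
  have hac : ∀ ε ∈ Ioo (0 : ℝ) 1, ∫ t in ε..1, F t = P 1 - P ε := by
    intro ε hε
    have hcst : ∀ c : ℝ, AbsolutelyContinuousOnInterval (fun _ : ℝ => c) ε 1 :=
      fun c => contDiffOn_const.absolutelyContinuousOnInterval
    have hlin : AbsolutelyContinuousOnInterval (fun t : ℝ => g1 0 * t) ε 1 :=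
      (contDiff_const.mul contDiff_id).contDiffOn.absolutelyContinuousOnInterval
    have hPac : AbsolutelyContinuousOnInterval P ε 1 := by
      refine AbsolutelyContinuousOnInterval.fun_add ?_ (AbsolutelyContinuousOnInterval.const_mul _ ?_)
      · exact (absolutelyContinuous_rpow hε.1 hε.2.le).fun_mul
          ((h.absolutelyContinuous hs hε.1.le hε.2.le).fun_sub (hcst _))
      · exact (absolutelyContinuous_rpow hε.1 hε.2.le).fun_mul
          (((h.absolutelyContinuous_fun hs hε.1.le hε.2.le).fun_sub (hcst _)).fun_sub hlin)
    rw [← hPac.integral_deriv_eq_sub]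
    apply intervalIntegral.integral_congr_ae
    filter_upwards [h.ae_hasDerivAt hs hε.1.le hε.2.le, Measure.ae_ne volume 1] with x hx hb hxm
    rw [uIoc_of_le hε.2.le] at hxm
    have hx0 : 0 < x := hε.1.trans hxm.1
    have d1 := ((Real.hasDerivAt_rpow_const (p := 1 - k) (Or.inl hx0.ne')).mul
      ((hx ⟨hxm.1, lt_of_le_of_ne hxm.2 hb⟩).sub_const (g1 0)))
    have d2 := (((Real.hasDerivAt_rpow_const (p := -k) (Or.inl hx0.ne')).mul
      (((h.hasDerivAt hx0).sub_const (g 0)).sub ((hasDerivAt_id x).const_mul (g1 0)))).const_mul (k - 1))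
    have := (d1.add d2).deriv
    simp only [hP, hF]
    refine Eq.trans ?_ this.symm
    simp only [Pi.sub_apply, id]
    rw [show (1 - k - 1) = -k by ring, show (-k - 1) = (-1 - k) by ring]
    ring
  have hlim1 : Tendsto (fun ε => ∫ t in ε..1, F t) (𝓝[>] 0) (𝓝 (∫ t in (0 : ℝ)..1, F t)) := by
    have := intervalIntegral.continuousOn_primitive_interval_left (f := F) (a := 0) (b := 1)
      (μ := volume) (by
        rw [uIcc_of_le zero_le_one, ← intervalIntegrable_iff_integrableOn_Icc_of_le zero_le_one]
        exact hFi)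
    rw [uIcc_of_le zero_le_one] at this
    refine (this 0 ⟨le_rfl, zero_le_one⟩).mono_left ?_
    rw [← nhdsWithin_Ioo_eq_nhdsGT (zero_lt_one' ℝ)]
    exact nhdsWithin_mono _ Ioo_subset_Icc_self
  -- Both boundary terms are `O(t^(2 - 1/s - k))`, a positive power.
  have hlim2 : Tendsto P (𝓝[>] 0) (𝓝 0) := by
    have hb : ∀ᶠ t in 𝓝[>] (0 : ℝ), ‖P t‖ ≤ k * S * t ^ (2 - 1 / s.toReal - k) := by
      filter_upwards [self_mem_nhdsWithin] with t ht
      have ht : 0 < t := ht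
      have b1 := h.abs_deriv_sub_le hs ht.le
      have b2 := h.abs_remainder_le hs ht.le
      have e1 : t ^ (2 - 1 / s.toReal - k) = t ^ (1 - k) * t ^ (1 - 1 / s.toReal) := by
        rw [← Real.rpow_add ht]; congr 1; ring
      have e2 : t ^ (2 - 1 / s.toReal - k) = t ^ (-k) * t ^ (2 - 1 / s.toReal) := by
        rw [← Real.rpow_add ht]; congr 1; ring
      have p1 := Real.rpow_pos_of_pos ht (1 - k)
      have p2 := Real.rpow_pos_of_pos ht (-k)
      calc ‖P t‖ ≤ |t ^ (1 - k) * (g1 t - g1 0)| +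
            |(k - 1) * (t ^ (-k) * (g t - g 0 - g1 0 * t))| := abs_add_le _ _
        _ = t ^ (1 - k) * |g1 t - g1 0| + (k - 1) * (t ^ (-k) * |g t - g 0 - g1 0 * t|) := by
          rw [abs_mul, abs_mul, abs_mul, abs_of_pos p1, abs_of_pos p2,
            abs_of_pos (by linarith : 0 < k - 1)]
        _ ≤ t ^ (1 - k) * (S * t ^ (1 - 1 / s.toReal)) +
            (k - 1) * (t ^ (-k) * (S * t ^ (2 - 1 / s.toReal))) := by
          have : 0 < k - 1 := by linarith
          gcongr
        _ = S * (t ^ (1 - k) * t ^ (1 - 1 / s.toReal)) +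
            (k - 1) * S * (t ^ (-k) * t ^ (2 - 1 / s.toReal)) := by ring
        _ = _ := by rw [← e1, ← e2]; ring
    refine squeeze_zero_norm' hb ?_
    have : Tendsto (fun t : ℝ => k * S * t ^ (2 - 1 / s.toReal - k)) (𝓝 0)
        (𝓝 (k * S * 0 ^ (2 - 1 / s.toReal - k))) :=
      ((Real.continuousAt_rpow_const 0 _ (Or.inr (by linarith))).tendsto).const_mul _
    rw [Real.zero_rpow (by linarith), mul_zero] at this
    exact this.mono_left nhdsWithin_le_nhds
  have hlim3 : Tendsto (fun ε => ∫ t in ε..1, F t) (𝓝[>] 0) (𝓝 (P 1 - 0)) := by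
    refine (tendsto_const_nhds.sub hlim2).congr' ?_
    filter_upwards [Ioo_mem_nhdsGT (zero_lt_one' ℝ)] with ε hε
    exact (hac ε hε).symm
  have hfin := tendsto_nhds_unique hlim1 hlim3
  simp only [hF] at hfin
  rw [intervalIntegral.integral_sub hi1 (hi2.const_mul _), intervalIntegral.integral_const_mul] at hfin
  simp only [hP, Real.one_rpow, one_mul, mul_one, sub_zero] at hfin
  linarith

end

/-! ### The kernel `τ` and the additive inequality -/

section

variable {s : ℝ≥0∞} {N S k a c : ℝ} {g g1 g2 : ℝ → ℝ}

/-- The kernel `τ` on `(0, 1]`, parametrised by the knot `a` and the descent `c` of the tent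
`ω^{[1]}` on `[a, 1]`. -/
noncomputable def chordTau (k a c t : ℝ) : ℝ := t ^ (1 - k) - t * ((1 + c) / max a t - c)

theorem measurable_chordTau : Measurable (chordTau k a c) := by
  unfold chordTau; fun_prop

theorem tent_nonneg (ha : a ≤ 1) (hc : 0 ≤ c) {t : ℝ} (ht : 0 < t) (ht1 : t ≤ 1) :
    0 ≤ t * ((1 + c) / max a t - c) := by
  have hm : 0 < max a t := lt_max_of_lt_right ht
  have hm1 : max a t ≤ 1 := max_le ha ht1
  have : 1 + c ≤ (1 + c) / max a t := by
    rw [le_div_iff₀ hm]; nlinarith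
  apply mul_nonneg ht.le; linarith

theorem tent_le (hc : 0 ≤ c) {t : ℝ} (ht : 0 < t) :
    t * ((1 + c) / max a t - c) ≤ 1 + c := by
  have hm : 0 < max a t := lt_max_of_lt_right ht
  have : t * ((1 + c) / max a t) ≤ 1 + c := by
    rw [mul_div_assoc', div_le_iff₀ hm, mul_comm]
    exact mul_le_mul_of_nonneg_left (le_max_right _ _) (by linarith)
  nlinarith

theorem one_le_rpow_one_sub (hk : 1 < k) {t : ℝ} (ht : 0 < t) (ht1 : t ≤ 1) : 1 ≤ t ^ (1 - k) :=
  Real.one_le_rpow_of_pos_of_le_one_of_nonpos ht ht1 (by linarith)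

theorem abs_chordTau_le (hk : 1 < k) (ha : a ≤ 1) (hc : 0 ≤ c) {t : ℝ} (ht : t ∈ Ioc (0 : ℝ) 1) :
    |chordTau k a c t| ≤ (1 + c) * t ^ (1 - k) := by
  have h0 := tent_nonneg ha hc ht.1 ht.2
  have h1 := tent_le (a := a) hc ht.1
  have h2 := one_le_rpow_one_sub hk ht.1 ht.2
  unfold chordTau
  rw [abs_le]
  constructor <;> nlinarith

theorem memLp_chordTau (hs : 1 < s) (hk : 1 < k) (hks : k < 2 - 1 / s.toReal) (ha : a ≤ 1)
    (hc : 0 ≤ c) :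
    MemLp (chordTau k a c) (ENNReal.ofReal (conjExp s)) (volume.restrict (Ioc 0 1)) :=
  memLp_conjExp_of_abs_le hs hk hks measurable_chordTau.aestronglyMeasurable
    fun _ ht => abs_chordTau_le hk ha hc ht

theorem Triple.integral_linear_mul (hs : 1 < s) (h : Triple s N S g g1 g2) {p q : ℝ} (hp : 0 ≤ p)
    (hpq : p ≤ q) (α β : ℝ) :
    ∫ t in p..q, (α + β * t) * g2 t =
      (α + β * q) * g1 q - (α + β * p) * g1 p - β * (g q - g p) := by
  have hd : ∀ t : ℝ, HasDerivAt (fun t : ℝ => α + β * t) β t := fun t => by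
    simpa using ((hasDerivAt_id t).const_mul β).const_add α
  rw [h.integral_mul hs hp hpq (u := fun t => α + β * t)
    (contDiff_const.add (contDiff_const.mul contDiff_id)).contDiffOn]
  congr 1
  simp only [(hd _).deriv]
  rw [intervalIntegral.integral_const_mul]
  congr 1
  refine intervalIntegral.integral_eq_sub_of_hasDerivAt_of_le hpq
    (h.continuousOn.mono fun x hx => hp.trans hx.1) (fun x hx => h.hasDerivAt (hp.trans_lt hx.1)) ?_
  refine ContinuousOn.intervalIntegrable ?_
  rw [uIcc_of_le hpq]
  exact (h.continuousOn_deriv hs).mono fun x hx => hp.trans hx.1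

/-- Integration by parts on the two linear pieces. The tent vanishes at 0 and is continuous at `a`,
so `g1 0` and `g1 a` drop out; its value 1 at 1 leaves `g1 1`. -/
theorem Triple.integral_tent_mul (hs : 1 < s) (h : Triple s N S g g1 g2) (ha : 0 < a)
    (ha1 : a ≤ 1) :
    IntervalIntegrable (fun t => t * ((1 + c) / max a t - c) * g2 t) volume 0 1 ∧
    ∫ t in (0 : ℝ)..1, t * ((1 + c) / max a t - c) * g2 t =
      g1 1 - ((1 + c) / a - c) * (g a - g 0) + c * (g 1 - g a) := by
  have i1 := intervalIntegrable_of_memLp hs h.memLp le_rfl ha.le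
  have i2 := intervalIntegrable_of_memLp hs h.memLp ha.le ha1
  have e1 : EqOn (fun t => (0 + ((1 + c) / a - c) * t) * g2 t)
      (fun t => t * ((1 + c) / max a t - c) * g2 t) (uIoc 0 a) := by
    intro t ht
    rw [uIoc_of_le ha.le] at ht
    simp only
    rw [max_eq_left ht.2]; ring
  have e2 : EqOn (fun t => ((1 + c) + (-c) * t) * g2 t)
      (fun t => t * ((1 + c) / max a t - c) * g2 t) (uIoc a 1) := by
    intro t ht
    rw [uIoc_of_le ha1] at ht
    have : t ≠ 0 := (ha.trans ht.1).ne'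
    simp only
    rw [max_eq_right ht.1.le]; field_simp; ring
  have j1 : IntervalIntegrable (fun t => t * ((1 + c) / max a t - c) * g2 t) volume 0 a :=
    (i1.continuousOn_mul (by fun_prop)).congr e1
  have j2 : IntervalIntegrable (fun t => t * ((1 + c) / max a t - c) * g2 t) volume a 1 :=
    (i2.continuousOn_mul (by fun_prop)).congr e2
  refine ⟨j1.trans j2, ?_⟩
  rw [← intervalIntegral.integral_add_adjacent_intervals j1 j2,
    ← intervalIntegral.integral_congr_ae (Eventually.of_forall e1),
    ← intervalIntegral.integral_congr_ae (Eventually.of_forall e2),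
    h.integral_linear_mul hs le_rfl ha.le, h.integral_linear_mul hs ha.le ha1]
  field_simp
  ring

theorem Triple.integrableOn_tail (hk : 1 < k) (h : Triple s N S g g1 g2) :
    IntegrableOn (fun t => g t * t ^ (-1 - k)) (Ioi 1) := by
  have hi := (integrableOn_Ioi_rpow_of_lt (a := -1 - k) (by linarith) one_pos).const_mul N
  have hsub : Ioi (1 : ℝ) ⊆ Ici 0 := fun t (ht : 1 < t) => (zero_le_one.trans ht.le : (0 : ℝ) ≤ t)
  refine Integrable.mono' hi ?_
    ((ae_restrict_iff' measurableSet_Ioi).2 (Eventually.of_forall fun t ht => ?_))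
  · exact ((h.continuousOn.mono hsub).aestronglyMeasurable measurableSet_Ioi).mul
      (measurable_rpow_const' _).aestronglyMeasurable
  · have ht0 : 0 ≤ t := hsub ht
    rw [norm_mul, Real.norm_of_nonneg (Real.rpow_nonneg ht0 _)]
    exact mul_le_mul_of_nonneg_right (h.bdd t ht0) (Real.rpow_nonneg ht0 _)

theorem integral_Ioi_one_rpow {k : ℝ} (hk : 0 < k) : ∫ t in Ioi (1 : ℝ), t ^ (-1 - k) = 1 / k := by
  rw [integral_Ioi_rpow_of_lt (by linarith) one_pos, Real.one_rpow]
  have : -1 - k + 1 = -k := by ring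
  rw [this]; field_simp

theorem Triple.integral_tail (hk : 1 < k) (h : Triple s N S g g1 g2) :
    ∫ t in Ioi (1 : ℝ), (g t - g 0 - g1 0 * t) * t ^ (-1 - k) =
      (∫ t in Ioi (1 : ℝ), g t * t ^ (-1 - k)) - g 0 / k - g1 0 / (k - 1) := by
  have i0 := integrableOn_Ioi_rpow_of_lt (a := -1 - k) (by linarith) one_pos
  have i1 := integrableOn_Ioi_rpow_of_lt (a := -1 - (k - 1)) (by linarith) one_pos
  have e : EqOn (fun t => (g t - g 0 - g1 0 * t) * t ^ (-1 - k))
      (fun t => g t * t ^ (-1 - k) - g 0 * t ^ (-1 - k) - g1 0 * t ^ (-1 - (k - 1))) (Ioi 1) := by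
    intro t ht
    have ht : 0 < t := zero_lt_one.trans ht
    have : t ^ (-1 - (k - 1)) = t ^ (-1 - k) * t := by
      rw [← Real.rpow_add_one ht.ne']; congr 1; ring
    simp only [this]; ring
  have i2 : IntegrableOn (fun t => g t * t ^ (-1 - k) - g 0 * t ^ (-1 - k)) (Ioi 1) :=
    (h.integrableOn_tail hk).sub (i0.const_mul _)
  rw [setIntegral_congr_fun measurableSet_Ioi e, integral_sub i2 (i1.const_mul _),
    integral_sub (h.integrableOn_tail hk) (i0.const_mul _), integral_const_mul, integral_const_mul,
    integral_Ioi_one_rpow (by linarith), integral_Ioi_one_rpow (by linarith)]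
  ring

theorem Triple.integrable_chordTau_mul (hs : 1 < s) (hk : 1 < k) (hks : k < 2 - 1 / s.toReal)
    (h : Triple s N S g g1 g2) (ha1 : a ≤ 1) (hc : 0 ≤ c) :
    IntervalIntegrable (fun t => chordTau k a c t * g2 t) volume 0 1 :=
  h.integrable_mul hs (memLp_chordTau hs hk hks ha1 hc)

/-- The fractional derivative at the origin as a functional of `g` and its second derivative. -/
theorem Triple.representation (hs : 1 < s) (hk : 1 < k) (hks : k < 2 - 1 / s.toReal)
    (h : Triple s N S g g1 g2) (ha : 0 < a) (ha1 : a ≤ 1) (hc : 0 ≤ c) :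
    k * (k - 1) * ∫ t in Ioi (0 : ℝ), (g t - g 0 - g1 0 * t) * t ^ (-1 - k) =
      (∫ t in (0 : ℝ)..1, chordTau k a c t * g2 t) + ((1 + c) / a - c) * g 0 - (1 + c) / a * g a +
        (1 - k + c) * g 1 + k * (k - 1) * ∫ t in Ioi (1 : ℝ), g t * t ^ (-1 - k) := by
  have hR := h.integrableOn_remainder hs hk hks
  have hsplit := setIntegral_union (Ioc_disjoint_Ioi (le_refl (1 : ℝ))) measurableSet_Ioi
    (hR.mono_set Ioc_subset_Ioi_self) (hR.mono_set (Ioi_subset_Ioi zero_le_one))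
  rw [Ioc_union_Ioi_eq_Ioi (zero_le_one' ℝ), ← intervalIntegral.integral_of_le zero_le_one,
    h.integral_tail hk] at hsplit
  obtain ⟨it, et⟩ := h.integral_tent_mul (c := c) hs ha ha1
  have eτ : ∫ t in (0 : ℝ)..1, t ^ (1 - k) * g2 t =
      (∫ t in (0 : ℝ)..1, chordTau k a c t * g2 t) +
        ∫ t in (0 : ℝ)..1, t * ((1 + c) / max a t - c) * g2 t := by
    rw [← intervalIntegral.integral_add (h.integrable_chordTau_mul hs hk hks ha1 hc) it]
    congr 1; ext t; unfold chordTau; ring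
  have hp := h.integral_rpow_mul hs hk hks
  rw [eτ, et] at hp
  rw [hsplit]
  have : k ≠ 0 := by linarith
  have : k - 1 ≠ 0 := by linarith
  have e : ∀ X Y u v : ℝ, k * (k - 1) * (X + (Y - u / k - v / (k - 1))) =
      k * (k - 1) * X + k * (k - 1) * Y - (k - 1) * u - k * v := by
    intro X Y u v; field_simp; ring
  rw [e]
  -- All first derivatives cancel: `g1 1` because the tent and `t^(1-k)` agree at 1, `g1 0` between
  -- the boundary terms and the tail.
  linear_combination -hp

/-! ### Hölder's inequality against the kernel -/

theorem eLpNorm_chordTau (hs : 1 < s) (hk : 1 < k) (hks : k < 2 - 1 / s.toReal)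
    (ha1 : a ≤ 1) (hc : 0 ≤ c) :
    eLpNorm (chordTau k a c) (ENNReal.ofReal (conjExp s)) (volume.restrict (Ioc 0 1)) =
      ENNReal.ofReal ((∫ t in (0 : ℝ)..1, |chordTau k a c t| ^ conjExp s) ^ (1 - 1 / s.toReal)) := by
  have hp := conjExp_ge_one hs
  rw [(memLp_chordTau hs hk hks ha1 hc).eLpNorm_eq_integral_rpow_norm (by simp; linarith)
    ENNReal.ofReal_ne_top, ENNReal.toReal_ofReal (by linarith),
    intervalIntegral.integral_of_le zero_le_one]
  simp [conjExp]

theorem Triple.abs_integral_chordTau_mul_le (hs : 1 < s) (hk : 1 < k) (hks : k < 2 - 1 / s.toReal)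
    (h : Triple s N S g g1 g2) (ha1 : a ≤ 1) (hc : 0 ≤ c) :
    |∫ t in (0 : ℝ)..1, chordTau k a c t * g2 t| ≤
      (∫ t in (0 : ℝ)..1, |chordTau k a c t| ^ conjExp s) ^ (1 - 1 / s.toReal) * S := by
  have hT : 0 ≤ (∫ t in (0 : ℝ)..1, |chordTau k a c t| ^ conjExp s) ^ (1 - 1 / s.toReal) :=
    Real.rpow_nonneg (intervalIntegral.integral_nonneg zero_le_one fun t _ => by positivity) _
  have := holderConjugate_conjExp hs
  rw [intervalIntegral.integral_of_le zero_le_one, ← Real.norm_eq_abs,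
    ← ENNReal.ofReal_le_ofReal_iff (mul_nonneg hT h.norm_nonneg), ofReal_norm]
  refine (enorm_integral_le_lintegral_enorm _).trans ?_
  rw [← eLpNorm_one_eq_lintegral_enorm, ENNReal.ofReal_mul hT, ← eLpNorm_chordTau hs hk hks ha1 hc]
  refine (eLpNorm_smul_le_mul_eLpNorm (p := ENNReal.ofReal (conjExp s)) (q := s)
    (memLp_restrict_Ioc h.memLp le_rfl).1 measurable_chordTau.aestronglyMeasurable).trans ?_
  exact mul_le_mul' le_rfl (eLpNorm_restrict_Ioc_le h.memLp le_rfl h.norm_le)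

/-- The additive inequality for the fractional derivative at the origin. -/
theorem Triple.additive_inequality (hs : 1 < s) (hk : 1 < k) (hks : k < 2 - 1 / s.toReal)
    (h : Triple s N S g g1 g2) (ha : 0 < a) (ha1 : a ≤ 1) (hc : k - 1 ≤ c) :
    k * (k - 1) * |∫ t in Ioi (0 : ℝ), (g t - g 0 - g1 0 * t) * t ^ (-1 - k)| ≤
      2 * (1 + c) / a * N +
      (∫ t in (0 : ℝ)..1, |chordTau k a c t| ^ conjExp s) ^ (1 - 1 / s.toReal) * S := by
  have hc0 : 0 ≤ c := by linarith
  have hkk : 0 < k * (k - 1) := mul_pos (by linarith) (by linarith)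
  have hA : c ≤ (1 + c) / a := by rw [le_div_iff₀ ha]; nlinarith
  rw [← abs_of_pos hkk, ← abs_mul, h.representation hs hk hks ha ha1 hc0]
  have t1 := h.abs_integral_chordTau_mul_le hs hk hks ha1 hc0
  have t5 : |∫ t in Ioi (1 : ℝ), g t * t ^ (-1 - k)| ≤ N / k := by
    have hi := (integrableOn_Ioi_rpow_of_lt (a := -1 - k) (by linarith) one_pos).const_mul N
    have := norm_integral_le_of_norm_le (f := fun t => g t * t ^ (-1 - k)) hi
      ((ae_restrict_iff' measurableSet_Ioi).2 (Eventually.of_forall fun t (ht : 1 < t) => by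
        have ht0 : 0 ≤ t := by linarith
        rw [norm_mul, Real.norm_of_nonneg (Real.rpow_nonneg ht0 (-1 - k))]
        exact mul_le_mul_of_nonneg_right (h.bdd t ht0) (Real.rpow_nonneg ht0 _)))
    rw [integral_const_mul, integral_Ioi_one_rpow (by linarith)] at this
    rw [div_eq_mul_one_div]; exact this
  have g0 := abs_le.1 (h.bdd 0 le_rfl)
  have ga := abs_le.1 (h.bdd a ha.le)
  have gg := abs_le.1 (h.bdd 1 zero_le_one)
  have t5' : |k * (k - 1) * ∫ t in Ioi (1 : ℝ), g t * t ^ (-1 - k)| ≤ (k - 1) * N := by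
    rw [abs_mul, abs_of_pos hkk]
    calc _ ≤ k * (k - 1) * (N / k) := by gcongr
      _ = _ := by field_simp
  have m1 : |((1 + c) / a - c) * g 0| ≤ ((1 + c) / a - c) * N := by
    rw [abs_mul, abs_of_nonneg (by linarith)]
    exact mul_le_mul_of_nonneg_left (h.bdd 0 le_rfl) (by linarith)
  have m2 : |(1 + c) / a * g a| ≤ (1 + c) / a * N := by
    rw [abs_mul, abs_of_nonneg (by linarith)]
    exact mul_le_mul_of_nonneg_left (h.bdd a ha.le) (by linarith)
  have m3 : |(1 - k + c) * g 1| ≤ (1 - k + c) * N := by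
    rw [abs_mul, abs_of_nonneg (by linarith)]
    exact mul_le_mul_of_nonneg_left (h.bdd 1 zero_le_one) (by linarith)
  -- The absolute weights of `g 0`, `g a`, `g 1` and the tail add up to `2(1+c)/a`; that of `g 1` is
  -- nonnegative exactly because `k - 1 ≤ c`.
  have e : 2 * (1 + c) / a * N = ((1 + c) / a - c) * N + (1 + c) / a * N + (1 - k + c) * N +
      (k - 1) * N := by ring
  rw [e]
  rw [abs_le] at *
  constructor <;> linarith

end

/-! ### Chords of the power function and signed powers -/

section

variable {k a b c p : ℝ}

theorem strictConvexOn_rpow_one_sub (hk : 1 < k) :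
    StrictConvexOn ℝ (Ioi 0) fun x : ℝ => x ^ (1 - k) := by
  have hd : ∀ x ∈ Ioi (0 : ℝ), deriv (fun x : ℝ => x ^ (1 - k)) x = (1 - k) * x ^ (-k) := by
    intro x hx
    rw [(Real.hasDerivAt_rpow_const (Or.inl (ne_of_gt hx))).deriv]
    congr 2; ring
  refine StrictMonoOn.strictConvexOn_of_deriv (convex_Ioi 0) (fun x hx =>
    (Real.continuousAt_rpow_const x _ (Or.inl (ne_of_gt hx))).continuousWithinAt) ?_
  rw [interior_Ioi]
  intro x hx y hy hxy
  rw [hd x hx, hd y hy]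
  have := Real.rpow_lt_rpow_of_neg (z := -k) hx hxy (by linarith)
  nlinarith

/-- The negative of the slope of the chord of `x ↦ x^{1-k}` between `b` and `1`, extended to
`b = 1` by continuity. -/
noncomputable def descent (k b : ℝ) : ℝ := -dslope (fun x : ℝ => x ^ (1 - k)) 1 b

theorem descent_of_ne (hb : b ≠ 1) : descent k b = (b ^ (1 - k) - 1) / (1 - b) := by
  have h1 : 1 - b ≠ 0 := sub_ne_zero.2 hb.symm
  have h2 : b - 1 ≠ 0 := sub_ne_zero.2 hb
  rw [descent, dslope_of_ne _ hb, slope_def_field, Real.one_rpow]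
  field_simp
  ring

theorem descent_one : descent k 1 = k - 1 := by
  have := (Real.hasDerivAt_rpow_const (x := 1) (p := 1 - k) (Or.inl one_ne_zero)).deriv
  rw [descent, dslope_same, this, Real.one_rpow]
  ring

theorem continuousOn_descent : ContinuousOn (descent k) (Ioi 0) := by
  refine ((continuousOn_dslope (Ioi_mem_nhds one_pos)).2 ⟨fun x hx =>
    (Real.continuousAt_rpow_const x _ (Or.inl (ne_of_gt hx))).continuousWithinAt,
    (Real.hasDerivAt_rpow_const (Or.inl one_ne_zero)).differentiableAt⟩).neg

/-- Secant slopes of a strictly convex function with the fixed endpoint 1 increase strictly, the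
tangent slope at 1 included. -/
theorem strictAntiOn_descent (hk : 1 < k) : StrictAntiOn (descent k) (Ioc 0 1) := by
  intro x hx y hy hxy
  have hx1 : x < 1 := hxy.trans_le hy.2
  have hsc := strictConvexOn_rpow_one_sub hk
  rcases hy.2.eq_or_lt with rfl | hy1
  · have := hsc.slope_lt_of_hasDerivAt hx.1 hy.1 hxy
      (Real.hasDerivAt_rpow_const (Or.inl one_ne_zero))
    rw [slope_def_field, Real.one_rpow, Real.one_rpow, div_lt_iff₀ (by linarith)] at this
    rw [descent_one, descent_of_ne hx1.ne, lt_div_iff₀ (by linarith)]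
    linarith
  · have := hsc.secant_strict_mono (mem_Ioi.2 (zero_lt_one' ℝ)) hx.1 hy.1 hx1.ne hy1.ne hxy
    rw [Real.one_rpow, ← neg_sub 1 x, ← neg_sub 1 y, div_neg, div_neg] at this
    rw [descent_of_ne hx1.ne, descent_of_ne hy1.ne]
    linarith

/-- Chord against tangent at 1. This is the condition on `c` in the additive inequality. -/
theorem descent_ge (hk : 1 < k) (hb : b ∈ Ioc (0 : ℝ) 1) : k - 1 ≤ descent k b := by
  rw [← descent_one]
  exact (strictAntiOn_descent hk).antitoneOn hb ⟨one_pos, le_rfl⟩ hb.2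

theorem rpow_eq_descent {t : ℝ} : t ^ (1 - k) = 1 + descent k t * (1 - t) := by
  rcases eq_or_ne t 1 with rfl | h
  · simp
  · have h1 : 1 - t ≠ 0 := sub_ne_zero.2 h.symm
    rw [descent_of_ne h]; field_simp; ring

/-- To the right of the knot the tent is the line of slope `-c` through `(1, 1)`, so on `[a, 1)` the
sign of `τ` is a comparison of chord slopes. The knot no longer appears. -/
theorem chordTau_of_ge (ht : 0 < t) (hat : a ≤ t) :
    chordTau k a c t = (1 - t) * (descent k t - c) := by
  rw [chordTau, max_eq_right hat, rpow_eq_descent]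
  field_simp
  ring

theorem chordTau_of_le {t : ℝ} (hat : t ≤ a) :
    chordTau k a c t = t ^ (1 - k) - t * ((1 + c) / a - c) := by
  rw [chordTau, max_eq_left hat]

/-- Right of `a` this compares slopes. Left of `a` the power exceeds its value at `a`, which
dominates the peak of the tent because `a ≤ b`, and the tent is largest at its peak. -/
theorem chordTau_pos (hk : 1 < k) (hab : a ≤ b) (hb : b ≤ 1) {t : ℝ} (ht : 0 < t) (htb : t < b) :
    0 < chordTau k a (descent k b) t := by
  have hbm : b ∈ Ioc (0 : ℝ) 1 := ⟨ht.trans htb, hb⟩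
  rcases le_or_gt a t with hat | hat
  · rw [chordTau_of_ge ht hat]
    have := strictAntiOn_descent hk ⟨ht, (htb.trans_le hb).le⟩ hbm htb
    apply mul_pos <;> linarith
  · have ha : 0 < a := ht.trans hat
    have h1 : a ^ (1 - k) < t ^ (1 - k) := Real.rpow_lt_rpow_of_neg ht hat (by linarith)
    have h2 : descent k b ≤ descent k a :=
      (strictAntiOn_descent hk).antitoneOn ⟨ha, hab.trans hb⟩ hbm hab
    have h3 := descent_ge hk hbm
    rw [rpow_eq_descent (t := a)] at h1
    rw [chordTau_of_le hat.le]
    have h4 : t * ((1 + descent k b) / a - descent k b) ≤ 1 + descent k b * (1 - a) := by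
      have e : 1 + descent k b * (1 - a) = a * ((1 + descent k b) / a - descent k b) := by
        field_simp; ring
      rw [e]
      refine mul_le_mul_of_nonneg_right hat.le ?_
      rw [sub_nonneg, le_div_iff₀ ha]
      nlinarith
    have h5 : descent k b * (1 - a) ≤ descent k a * (1 - a) :=
      mul_le_mul_of_nonneg_right h2 (by linarith)
    linarith

theorem chordTau_neg (hk : 1 < k) (hab : a ≤ b) (hb : 0 < b) {t : ℝ} (htb : b < t) (ht : t < 1) :
    chordTau k a (descent k b) t < 0 := by
  rw [chordTau_of_ge (hb.trans htb) (hab.trans htb.le)]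
  have := strictAntiOn_descent hk ⟨hb, (htb.trans ht).le⟩ ⟨hb.trans htb, ht.le⟩ htb
  apply mul_neg_of_pos_of_neg <;> linarith

/-- Moving the knot to the right or reducing the descent lowers the tent on `(0, 1]`. All
monotonicity of the system in `a` inside the kernel and in `b` comes from this. -/
theorem chordTau_mono {a' c' : ℝ} (haa : a ≤ a') (hcc : c' ≤ c) (hc : 0 ≤ c') (ha : a' ≤ 1)
    {t : ℝ} (ht : 0 < t) (ht1 : t ≤ 1) : chordTau k a c t ≤ chordTau k a' c' t := by
  unfold chordTau
  have hm : 0 < max a t := lt_max_of_lt_right ht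
  have hm' : 0 < max a' t := lt_max_of_lt_right ht
  have h1 : max a t ≤ max a' t := max_le_max haa le_rfl
  have h2 : max a' t ≤ 1 := max_le ha ht1
  have h3 : (1 + c') / max a' t ≤ (1 + c') / max a t := by gcongr
  have h4 : c - c' ≤ (c - c') / max a t := by
    rw [le_div_iff₀ hm]; nlinarith
  have h5 : (1 + c) / max a t = (1 + c') / max a t + (c - c') / max a t := by
    rw [← add_div]; congr 1; ring
  have : (1 + c') / max a' t - c' ≤ (1 + c) / max a t - c := by linarith
  have := mul_le_mul_of_nonneg_left this ht.le
  linarith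

/-- The signed power `|y|^{p-1} sign y`. -/
noncomputable def signedPow (p y : ℝ) : ℝ := |y| ^ (p - 1) * Real.sign y

theorem signedPow_of_pos {y : ℝ} (hy : 0 < y) : signedPow p y = y ^ (p - 1) := by
  rw [signedPow, Real.sign_of_pos hy, abs_of_pos hy, mul_one]

theorem signedPow_of_neg {y : ℝ} (hy : y < 0) : signedPow p y = -(-y) ^ (p - 1) := by
  rw [signedPow, Real.sign_of_neg hy, abs_of_neg hy]; ring

theorem signedPow_zero : signedPow p 0 = 0 := by simp [signedPow]

theorem signedPow_pos {y : ℝ} (hy : 0 < y) : 0 < signedPow p y := by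
  rw [signedPow_of_pos hy]; exact Real.rpow_pos_of_pos hy _

theorem signedPow_neg {y : ℝ} (hy : y < 0) : signedPow p y < 0 := by
  rw [signedPow_of_neg hy, neg_lt_zero]; exact Real.rpow_pos_of_pos (by linarith) _

theorem monotone_signedPow (hp : 1 ≤ p) : Monotone (signedPow p) := by
  intro y z hyz
  rcases lt_trichotomy y 0 with hy | rfl | hy
  · rcases lt_trichotomy z 0 with hz | rfl | hz
    · rw [signedPow_of_neg hy, signedPow_of_neg hz, neg_le_neg_iff]
      exact Real.rpow_le_rpow (by linarith) (by linarith) (by linarith)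
    · rw [signedPow_zero]; exact (signedPow_neg hy).le
    · exact ((signedPow_neg hy).trans (signedPow_pos hz)).le
  · rcases hyz.eq_or_lt with rfl | hz
    · exact le_rfl
    · rw [signedPow_zero]; exact (signedPow_pos hz).le
  · rw [signedPow_of_pos hy, signedPow_of_pos (hy.trans_le hyz)]
    exact Real.rpow_le_rpow hy.le hyz (by linarith)

theorem abs_signedPow_le {y : ℝ} : |signedPow p y| ≤ |y| ^ (p - 1) := by
  rw [signedPow, abs_mul, abs_of_nonneg (Real.rpow_nonneg (abs_nonneg y) _)]
  refine mul_le_of_le_one_right (Real.rpow_nonneg (abs_nonneg y) _) ?_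
  rcases Real.sign_apply_eq y with h | h | h <;> simp [h]

theorem abs_signedPow_of_ne {y : ℝ} (hy : y ≠ 0) : |signedPow p y| = |y| ^ (p - 1) := by
  rw [signedPow, abs_mul, abs_of_nonneg (Real.rpow_nonneg (abs_nonneg y) _)]
  rcases Real.sign_apply_eq_of_ne_zero y hy with h | h <;> simp [h]

theorem mul_signedPow (hp : 1 ≤ p) (y : ℝ) : y * signedPow p y = |y| ^ p := by
  rcases eq_or_ne y 0 with rfl | hy
  · rw [abs_zero, Real.zero_rpow (by linarith), zero_mul]
  · have h : y * Real.sign y = |y| := by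
      rcases hy.lt_or_gt with h | h
      · rw [Real.sign_of_neg h, abs_of_neg h]; ring
      · rw [Real.sign_of_pos h, abs_of_pos h, mul_one]
    rw [signedPow, mul_left_comm, h, ← Real.rpow_add_one (abs_ne_zero.2 hy)]
    congr 1; ring

/-- The origin is excluded because for `p = 1`, that is `s = ∞`, the signed power is the sign
function. Limits under the integral therefore require a limit that is nonzero almost everywhere. -/
theorem continuousAt_signedPow {y : ℝ} (hy : y ≠ 0) : ContinuousAt (signedPow p) y := by
  rcases hy.lt_or_gt with h | h
  · have : ContinuousAt (fun y : ℝ => -(-y) ^ (p - 1)) y :=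
      ((continuousAt_id.neg).rpow_const (Or.inl (by simpa using hy))).neg
    refine this.congr ?_
    filter_upwards [Iio_mem_nhds h] with z hz
    exact (signedPow_of_neg hz).symm
  · refine (continuousAt_id.rpow_const (p := p - 1) (Or.inl hy)).congr ?_
    filter_upwards [Ioi_mem_nhds h] with z hz
    exact (signedPow_of_pos hz).symm

theorem measurable_signedPow (hp : 1 ≤ p) : Measurable (signedPow p) :=
  (monotone_signedPow hp).measurable

end

/-! ### The two integrals of the system -/

section

variable {k a b c p : ℝ}

theorem integral_lt_of_le_of_lt_on {f g : ℝ → ℝ} {x y u v : ℝ} (hxy : x ≤ y)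
    (hf : IntervalIntegrable f volume x y) (hg : IntervalIntegrable g volume x y)
    (hle : ∀ t ∈ Ioo x y, f t ≤ g t) (huv : u < v) (hxu : x ≤ u) (hvy : v ≤ y)
    (hlt : ∀ t ∈ Ioo u v, f t < g t) : ∫ t in x..y, f t < ∫ t in x..y, g t := by
  refine intervalIntegral.integral_lt_integral_of_ae_le_of_measure_setOfPred_lt_ne_zero hxy hf hg ?_ ?_
  · rw [EventuallyLE, ae_restrict_iff' measurableSet_Ioc]
    filter_upwards [Measure.ae_ne volume y] with t ht htm
    exact hle t ⟨htm.1, lt_of_le_of_ne htm.2 ht⟩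
  · have hsub : Ioo u v ⊆ Ioc x y := fun t ht => ⟨hxu.trans_lt ht.1, ht.2.le.trans hvy⟩
    refine ne_of_gt (lt_of_lt_of_le ?_ (measure_mono (s := Ioo u v) hlt))
    rw [Measure.restrict_apply measurableSet_Ioo, inter_eq_left.2 hsub, Real.volume_Ioo]
    simpa using huv

/-- The conditions on the exponents used for the integrals of `signedPow p ∘ τ`. -/
structure Admissible (k p : ℝ) : Prop where
  one_lt : 1 < k
  one_le : 1 ≤ p
  lt : -1 < (1 - k) * p

theorem Admissible.of_space {s : ℝ≥0∞} (hs : 1 < s) (hk : 1 < k) (hks : k < 2 - 1 / s.toReal) :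
    Admissible k (conjExp s) :=
  ⟨hk, conjExp_ge_one hs, rpow_mul_conjExp_gt hs hk hks⟩

theorem Admissible.lt' (h : Admissible k p) : -1 < (1 - k) * (p - 1) := by
  have := h.lt; have := h.one_lt; linarith

theorem abs_signedPow_chordTau_le (h : Admissible k p) (ha : a ≤ 1) (hc : 0 ≤ c) {t : ℝ}
    (ht : t ∈ Ioc (0 : ℝ) 1) :
    |signedPow p (chordTau k a c t)| ≤ (1 + c) ^ (p - 1) * t ^ ((1 - k) * (p - 1)) := by
  refine abs_signedPow_le.trans ?_
  rw [Real.rpow_mul ht.1.le, ← Real.mul_rpow (by linarith) (Real.rpow_nonneg ht.1.le _)]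
  exact Real.rpow_le_rpow (abs_nonneg _) (abs_chordTau_le h.one_lt ha hc ht)
    (by linarith [h.one_le])

theorem measurable_signedPow_chordTau (h : Admissible k p) :
    Measurable fun t => signedPow p (chordTau k a c t) :=
  (measurable_signedPow h.one_le).comp measurable_chordTau

theorem integrable_signedPow_chordTau (h : Admissible k p) (ha : a ≤ 1) (hc : 0 ≤ c) :
    IntervalIntegrable (fun t => signedPow p (chordTau k a c t)) volume 0 1 := by
  refine ((intervalIntegral.intervalIntegrable_rpow' h.lt').const_mul ((1 + c) ^ (p - 1))).mono_fun'
    (measurable_signedPow_chordTau h).aestronglyMeasurable ?_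
  rw [uIoc_of_le zero_le_one, EventuallyLE, ae_restrict_iff' measurableSet_Ioc]
  exact Eventually.of_forall fun t ht => abs_signedPow_chordTau_le h ha hc ht

theorem integrable_signedPow_chordTau_sub (h : Admissible k p) (ha : a ≤ 1) (hc : 0 ≤ c) {x y : ℝ}
    (hx : x ∈ Icc (0 : ℝ) 1) (hy : y ∈ Icc (0 : ℝ) 1) :
    IntervalIntegrable (fun t => signedPow p (chordTau k a c t)) volume x y :=
  (integrable_signedPow_chordTau h ha hc).mono_set (by
    rw [uIcc_of_le zero_le_one]; exact uIcc_subset_Icc hx hy)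

/-- Dominated convergence with a majorant depending only on a bound `C` for the descents. The
general filter covers continuity in `b`, continuity along the curve of zeros, and the limit `a → 1`.
-/
theorem tendsto_integral_signedPow (h : Admissible k p) {ι : Type*} {l : Filter ι}
    [l.IsCountablyGenerated] {α γ : ι → ℝ} {C x y : ℝ} (hx : x ∈ Icc (0 : ℝ) 1)
    (hy : y ∈ Icc (0 : ℝ) 1) {w u : ℝ → ℝ} (hw : Measurable w) (hw1 : ∀ t ∈ Ioc (0 : ℝ) 1, |w t| ≤ 1)
    (hα : ∀ᶠ i in l, α i ≤ 1) (hγ : ∀ᶠ i in l, 0 ≤ γ i ∧ γ i ≤ C)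
    (hlim : ∀ᵐ t : ℝ, t ∈ Ioo (0 : ℝ) 1 →
      u t ≠ 0 ∧ Tendsto (fun i => chordTau k (α i) (γ i) t) l (𝓝 (u t))) :
    Tendsto (fun i => ∫ t in x..y, w t * signedPow p (chordTau k (α i) (γ i) t)) l
      (𝓝 (∫ t in x..y, w t * signedPow p (u t))) := by
  have hsub : uIoc x y ⊆ Ioc 0 1 := by
    rw [← uIoc_of_le zero_le_one]
    exact uIoc_subset_uIoc_of_uIcc_subset_uIcc (by
      rw [uIcc_of_le zero_le_one]; exact uIcc_subset_Icc hx hy)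
  refine intervalIntegral.tendsto_integral_filter_of_dominated_convergence
    (fun t => (1 + C) ^ (p - 1) * t ^ ((1 - k) * (p - 1)))
    (Eventually.of_forall fun i => (hw.mul (measurable_signedPow_chordTau h)).aestronglyMeasurable)
    ?_ ((intervalIntegral.intervalIntegrable_rpow' h.lt').const_mul _) ?_
  · filter_upwards [hα, hγ] with i hi hi'
    refine Eventually.of_forall fun t ht => ?_
    have ht' := hsub ht
    have h1 := abs_signedPow_chordTau_le h hi hi'.1 ht'
    have h0 : 0 ≤ t ^ ((1 - k) * (p - 1)) := Real.rpow_nonneg ht'.1.le _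
    rw [norm_mul]
    refine (mul_le_of_le_one_left (norm_nonneg _) (hw1 t ht')).trans (h1.trans ?_)
    refine mul_le_mul_of_nonneg_right (Real.rpow_le_rpow (by linarith) (by linarith) ?_) h0
    linarith [h.one_le]
  · filter_upwards [hlim, Measure.ae_ne volume 1] with t ht ht1 htm
    have htm := hsub htm
    obtain ⟨h1, h2⟩ := ht ⟨htm.1, lt_of_le_of_ne htm.2 ht1⟩
    exact ((continuousAt_signedPow h1).tendsto.comp h2).const_mul _

/-- The first integral of the system. -/
noncomputable def sysF (k p a b : ℝ) : ℝ :=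
  ∫ t in a..1, signedPow p (chordTau k 0 (descent k b) t)

/-- The second integral of the system. -/
noncomputable def sysH (k p a b : ℝ) : ℝ :=
  ∫ t in (0 : ℝ)..1, t * signedPow p (chordTau k a (descent k b) t)

theorem integrable_signedPow_descent (h : Admissible k p) (ha : a ≤ 1) (hb : b ∈ Ioc (0 : ℝ) 1)
    {x y : ℝ} (hx : x ∈ Icc (0 : ℝ) 1) (hy : y ∈ Icc (0 : ℝ) 1) :
    IntervalIntegrable (fun t => signedPow p (chordTau k a (descent k b) t)) volume x y :=
  integrable_signedPow_chordTau_sub h ha (by linarith [h.one_lt, descent_ge h.one_lt hb]) hx hy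

/-- A larger `b` means a smaller descent and so a larger `τ`. Strictness comes from the sign change
on `(max a b, b')`, since for `p = 1` the signed power is not strictly increasing. -/
theorem sysF_strictMono (h : Admissible k p) {b' : ℝ} (ha : 0 ≤ a) (hb : 0 < b) (hbb : b < b')
    (hb' : b' ≤ 1) (hab : a < b') : sysF k p a b < sysF k p a b' := by
  have hbm : b ∈ Ioc (0 : ℝ) 1 := ⟨hb, hbb.le.trans hb'⟩
  have hbm' : b' ∈ Ioc (0 : ℝ) 1 := ⟨hb.trans hbb, hb'⟩
  have ha1 : a ≤ 1 := hab.le.trans hb'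
  refine integral_lt_of_le_of_lt_on (u := max a b) (v := b') ha1
    (integrable_signedPow_descent h zero_le_one hbm ⟨ha, ha1⟩ ⟨zero_le_one, le_rfl⟩)
    (integrable_signedPow_descent h zero_le_one hbm' ⟨ha, ha1⟩ ⟨zero_le_one, le_rfl⟩)
    (fun t ht => monotone_signedPow h.one_le ?_) (max_lt hab hbb) (le_max_left _ _) hb'
    (fun t ht => ?_)
  · exact chordTau_mono le_rfl ((strictAntiOn_descent h.one_lt).antitoneOn hbm hbm' hbb.le)
      (by linarith [h.one_lt, descent_ge h.one_lt hbm']) zero_le_one (ha.trans_lt ht.1) ht.2.le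
  · have htb : b < t := (le_max_right _ _).trans_lt ht.1
    exact (signedPow_neg (chordTau_neg h.one_lt hb.le hb htb (ht.2.trans_le hb'))).trans
      (signedPow_pos (chordTau_pos h.one_lt hbm'.1.le hb' (hb.trans htb) ht.2))

theorem sysF_one_pos (h : Admissible k p) (ha : 0 ≤ a) (ha1 : a < 1) : 0 < sysF k p a 1 := by
  refine intervalIntegral.intervalIntegral_pos_of_pos_on
    (integrable_signedPow_descent h zero_le_one ⟨one_pos, le_rfl⟩ ⟨ha, ha1.le⟩ ⟨zero_le_one, le_rfl⟩)
    (fun t ht => signedPow_pos (chordTau_pos h.one_lt zero_le_one le_rfl (ha.trans_lt ht.1) ht.2)) ha1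

theorem integral_signedPow_neg (h : Admissible k p) (hb : 0 < b) {x : ℝ} (hbx : b ≤ x)
    (hx : x < 1) : ∫ t in x..1, signedPow p (chordTau k 0 (descent k b) t) < 0 := by
  have := intervalIntegral.intervalIntegral_pos_of_pos_on
    (f := fun t => -signedPow p (chordTau k 0 (descent k b) t)) (a := x) (b := 1)
    (integrable_signedPow_descent h zero_le_one ⟨hb, hbx.trans hx.le⟩ ⟨hb.le.trans hbx, hx.le⟩
      ⟨zero_le_one, le_rfl⟩).neg
    (fun t ht => neg_pos.2 (signedPow_neg
      (chordTau_neg h.one_lt hb.le hb (hbx.trans_lt ht.1) ht.2))) hx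
  rw [intervalIntegral.integral_neg] at this
  linarith

theorem sysF_self_neg (h : Admissible k p) (ha : 0 < a) (ha1 : a < 1) : sysF k p a a < 0 :=
  integral_signedPow_neg h ha le_rfl ha1

/-- For `b = ε` small, the positive part lives on `(0, ε)` under an integrable power and is
negligible. On `(1/2, 1)` the integrand lies below the one for `b = 1/2`, whose integral there is a
fixed negative number `-δ`. -/
theorem exists_sysF_zero_neg (h : Admissible k p) : ∃ b ∈ Ioo (0 : ℝ) 1, sysF k p 0 b < 0 := by
  set δ := -∫ t in (1 / 2 : ℝ)..1, signedPow p (chordTau k 0 (descent k (1 / 2)) t) with hδ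
  have hδ0 : 0 < δ := by
    have := integral_signedPow_neg (b := 1 / 2) (x := 1 / 2) h (by norm_num) le_rfl (by norm_num)
    linarith
  set r := (1 - k) * (p - 1) with hr
  have hr1 : -1 < r := h.lt'
  have hcont : Tendsto (fun ε : ℝ => ∫ t in (0 : ℝ)..ε, t ^ r) (𝓝[>] 0) (𝓝 0) := by
    have e : ∀ ε : ℝ, ∫ t in (0 : ℝ)..ε, t ^ r = ε ^ (r + 1) / (r + 1) := fun ε => by
      rw [integral_rpow (Or.inl hr1), Real.zero_rpow (by linarith), sub_zero]
    simp only [e]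
    have := ((Real.continuousAt_rpow_const 0 (r + 1) (Or.inr (by linarith))).tendsto).div_const (r + 1)
    rw [Real.zero_rpow (by linarith), zero_div] at this
    exact this.mono_left nhdsWithin_le_nhds
  obtain ⟨ε, hε, hεm⟩ := ((hcont.eventually (gt_mem_nhds hδ0)).and
    (Ioo_mem_nhdsGT (show (0 : ℝ) < 1 / 2 by norm_num))).exists
  have hε1 : ε < 1 := by linarith [hεm.2]
  have hem : ε ∈ Ioc (0 : ℝ) 1 := ⟨hεm.1, hε1.le⟩
  have hc0 : 0 ≤ descent k ε := by linarith [h.one_lt, descent_ge h.one_lt hem]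
  refine ⟨ε, ⟨hεm.1, hε1⟩, ?_⟩
  have hint : ∀ x y : ℝ, 0 ≤ x → x ≤ 1 → 0 ≤ y → y ≤ 1 →
      IntervalIntegrable (fun t => signedPow p (chordTau k 0 (descent k ε) t)) volume x y :=
    fun x y h1 h2 h3 h4 => integrable_signedPow_descent h zero_le_one hem ⟨h1, h2⟩ ⟨h3, h4⟩
  have i1 := hint 0 ε le_rfl zero_le_one hεm.1.le hε1.le
  have i2 := hint ε (1 / 2) hεm.1.le hε1.le (by norm_num) (by norm_num)
  have i3 := hint (1 / 2) 1 (by norm_num) (by norm_num) (by norm_num) le_rfl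
  have b1 : ∫ t in (0 : ℝ)..ε, signedPow p (chordTau k 0 (descent k ε) t) ≤
      ∫ t in (0 : ℝ)..ε, t ^ r := by
    refine intervalIntegral.integral_mono_on_of_le_Ioo hεm.1.le i1
      (intervalIntegral.intervalIntegrable_rpow' hr1) fun t ht => ?_
    have ht1 : t ≤ 1 := by linarith [ht.2]
    have h1 : chordTau k 0 (descent k ε) t ≤ t ^ (1 - k) := by
      have := tent_nonneg (a := 0) zero_le_one hc0 ht.1 ht1
      unfold chordTau; linarith
    refine (monotone_signedPow h.one_le h1).trans ?_
    rw [signedPow_of_pos (Real.rpow_pos_of_pos ht.1 _), hr, Real.rpow_mul ht.1.le]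
  have b2 : ∫ t in ε..(1 / 2), signedPow p (chordTau k 0 (descent k ε) t) ≤ 0 := by
    refine (intervalIntegral.integral_mono_on_of_le_Ioo hεm.2.le i2
      (intervalIntegrable_const (c := (0 : ℝ))) fun t ht => ?_).trans (by simp)
    exact (signedPow_neg (chordTau_neg h.one_lt hεm.1.le hεm.1 ht.1 (by linarith [ht.2]))).le
  have b3 : ∫ t in (1 / 2 : ℝ)..1, signedPow p (chordTau k 0 (descent k ε) t) ≤ -δ := by
    rw [hδ, neg_neg]
    have hh : (1 / 2 : ℝ) ∈ Ioc (0 : ℝ) 1 := by norm_num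
    refine intervalIntegral.integral_mono_on_of_le_Ioo (by norm_num) i3
      (integrable_signedPow_descent h zero_le_one hh (by norm_num) (by norm_num)) fun t ht => ?_
    refine monotone_signedPow h.one_le (chordTau_mono le_rfl
      ((strictAntiOn_descent h.one_lt).antitoneOn hem hh hεm.2.le)
      (by linarith [h.one_lt, descent_ge h.one_lt hh]) zero_le_one (by linarith [ht.1]) ht.2.le)
  unfold sysF
  rw [← intervalIntegral.integral_add_adjacent_intervals i1
    (hint ε 1 hεm.1.le hε1.le zero_le_one le_rfl),
    ← intervalIntegral.integral_add_adjacent_intervals i2 i3]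
  linarith

/-! ### Continuity of the first integral and its zero in `b` -/

theorem chordTau_ne_zero (hk : 1 < k) (hab : a ≤ b) (hb : 0 < b) (hb1 : b ≤ 1) :
    ∀ᵐ t : ℝ, t ∈ Ioo (0 : ℝ) 1 → chordTau k a (descent k b) t ≠ 0 := by
  filter_upwards [Measure.ae_ne volume b] with t htb ht
  rcases htb.lt_or_gt with h | h
  · exact (chordTau_pos hk hab hb1 ht.1 h).ne'
  · exact (chordTau_neg hk hab hb h ht.2).ne

theorem tendsto_chordTau {ι : Type*} {l : Filter ι} {α β : ι → ℝ} (hα : Tendsto α l (𝓝 a))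
    (hβ : Tendsto β l (𝓝 b)) (hb : 0 < b) {t : ℝ} (ht : 0 < t) :
    Tendsto (fun i => chordTau k (α i) (descent k (β i)) t) l
      (𝓝 (chordTau k a (descent k b) t)) := by
  have hd : Tendsto (fun i => descent k (β i)) l (𝓝 (descent k b)) :=
    (continuousOn_descent.continuousAt (Ioi_mem_nhds hb)).tendsto.comp hβ
  exact tendsto_const_nhds.sub ((((hd.const_add 1).div (hα.max tendsto_const_nhds)
    (lt_max_of_lt_right ht).ne').sub hd).const_mul t)

theorem descent_bounds (hk : 1 < k) {ι : Type*} {l : Filter ι} {β : ι → ℝ}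
    (hβ : Tendsto β l (𝓝 b)) (hb : 0 < b) (hβ1 : ∀ᶠ i in l, β i ≤ 1) :
    ∀ᶠ i in l, 0 ≤ descent k (β i) ∧ descent k (β i) ≤ descent k b + 1 := by
  have hd : Tendsto (fun i => descent k (β i)) l (𝓝 (descent k b)) :=
    (continuousOn_descent.continuousAt (Ioi_mem_nhds hb)).tendsto.comp hβ
  filter_upwards [hβ1, hβ.eventually (lt_mem_nhds hb), hd.eventually (gt_mem_nhds (lt_add_one _))]
    with i h1 h2 h3
  exact ⟨by linarith [descent_ge hk ⟨h2, h1⟩], h3.le⟩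

theorem continuousOn_sysF (h : Admissible k p) (ha : a ∈ Icc (0 : ℝ) 1) :
    ContinuousOn (sysF k p a) (Ioc 0 1) := by
  intro b hb
  have := tendsto_integral_signedPow h (l := 𝓝[Ioc 0 1] b) (α := fun _ => 0) (γ := descent k)
    (C := descent k b + 1) (x := a) (y := 1) (w := fun _ => 1) (u := chordTau k 0 (descent k b))
    ha ⟨zero_le_one, le_rfl⟩ measurable_const (fun _ _ => by simp)
    (Eventually.of_forall fun _ => zero_le_one)
    (descent_bounds h.one_lt (tendsto_id.mono_left nhdsWithin_le_nhds) hb.1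
      (by filter_upwards [self_mem_nhdsWithin] with x hx using hx.2)) (by
    filter_upwards [chordTau_ne_zero h.one_lt hb.1.le hb.1 hb.2] with t ht htm
    exact ⟨ht htm, tendsto_chordTau tendsto_const_nhds (tendsto_id.mono_left nhdsWithin_le_nhds)
      hb.1 htm.1⟩)
  simp only [one_mul] at this
  exact this

theorem continuousOn_sysF_left (h : Admissible k p) (hb : b ∈ Ioc (0 : ℝ) 1) :
    ContinuousOn (fun a => sysF k p a b) (Icc 0 1) := by
  have := intervalIntegral.continuousOn_primitive_interval_left (a := 0) (b := 1) (μ := volume)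
    (f := fun t => signedPow p (chordTau k 0 (descent k b) t)) (by
      rw [uIcc_of_le zero_le_one, ← intervalIntegrable_iff_integrableOn_Icc_of_le zero_le_one]
      exact integrable_signedPow_descent h zero_le_one hb ⟨le_rfl, zero_le_one⟩ ⟨zero_le_one, le_rfl⟩)
  rwa [uIcc_of_le zero_le_one] at this

/-- Intermediate values in `b`, up to `b = 1` where the integrand is positive. For `a > 0` one
starts at `b = a`, where it is negative on `(a, 1)`; for `a = 0` the start is the small `b` of
`exists_sysF_zero_neg`. -/
theorem exists_sysF_eq_zero (h : Admissible k p) (ha : 0 ≤ a) (ha1 : a < 1) :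
    ∃ b ∈ Ioo a 1, sysF k p a b = 0 := by
  obtain ⟨b0, hb0, hab, hF⟩ : ∃ b0 ∈ Ioo (0 : ℝ) 1, a ≤ b0 ∧ sysF k p a b0 < 0 := by
    rcases ha.eq_or_lt with rfl | ha0
    · obtain ⟨b, hb, hF⟩ := exists_sysF_zero_neg h
      exact ⟨b, hb, hb.1.le, hF⟩
    · exact ⟨a, ⟨ha0, ha1⟩, le_rfl, sysF_self_neg h ha0 ha1⟩
  obtain ⟨b, hb, hbF⟩ := intermediate_value_Icc hb0.2.le
    ((continuousOn_sysF h ⟨ha, ha1.le⟩).mono fun x hx => ⟨hb0.1.trans_le hx.1, hx.2⟩)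
    ⟨hF.le, (sysF_one_pos h ha ha1).le⟩
  refine ⟨b, ⟨lt_of_le_of_ne (hab.trans hb.1) ?_, lt_of_le_of_ne hb.2 ?_⟩, hbF⟩
  · rintro rfl
    have := sysF_self_neg h (hb0.1.trans_le hb.1) ha1
    linarith
  · rintro rfl
    have := sysF_one_pos h ha ha1
    linarith

/-- The piece `(a, a')` that is removed lies left of `b`, where the integrand is positive. -/
theorem sysF_antitone (h : Admissible k p) {a' : ℝ} (ha : 0 ≤ a) (haa : a < a') (ha' : a' ≤ b)
    (hb : b ≤ 1) : sysF k p a' b < sysF k p a b := by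
  have hbm : b ∈ Ioc (0 : ℝ) 1 := ⟨(ha.trans_lt haa).trans_le ha', hb⟩
  have ha1 : a ∈ Icc (0 : ℝ) 1 := ⟨ha, by linarith⟩
  have ha1' : a' ∈ Icc (0 : ℝ) 1 := ⟨by linarith, by linarith⟩
  have i1 := integrable_signedPow_descent h zero_le_one hbm ha1 ha1'
  have := intervalIntegral.intervalIntegral_pos_of_pos_on i1 (fun t ht => signedPow_pos
    (chordTau_pos h.one_lt hbm.1.le hb (ha.trans_lt ht.1) (ht.2.trans_le ha'))) haa
  unfold sysF
  rw [← intervalIntegral.integral_add_adjacent_intervals i1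
    (integrable_signedPow_descent h zero_le_one hbm ha1' ⟨zero_le_one, le_rfl⟩)]
  linarith

/-- Moving `a` to the right lowers the first integral, so `b` must move to the right to restore the
value 0. -/
theorem lt_of_sysF_eq_zero (h : Admissible k p) {a' b' : ℝ} (ha : 0 ≤ a) (haa : a < a')
    (hb : b < 1) (hab : a < b) (hab' : a' < b') (hF : sysF k p a b = 0)
    (hF' : sysF k p a' b' = 0) : b < b' := by
  by_contra! hle
  have h1 := sysF_antitone h ha haa (hab'.le.trans hle) hb.le
  rcases hle.eq_or_lt with rfl | hlt
  · linarith
  · have := sysF_strictMono h (by linarith) (by linarith) hlt hb.le (by linarith : a' < b)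
    linarith

/-- Both changes raise `τ`, and on `(b, b')` its sign passes from negative to positive. -/
theorem sysH_lt (h : Admissible k p) {a' b' : ℝ} (haa : a ≤ a') (hab : a ≤ b)
    (hb : 0 < b) (hbb : b < b') (hab' : a' ≤ b') (hb' : b' ≤ 1) :
    sysH k p a b < sysH k p a' b' := by
  have hbm : b ∈ Ioc (0 : ℝ) 1 := ⟨hb, hbb.le.trans hb'⟩
  have hbm' : b' ∈ Ioc (0 : ℝ) 1 := ⟨hb.trans hbb, hb'⟩
  have h01 : (0 : ℝ) ∈ Icc (0 : ℝ) 1 := ⟨le_rfl, zero_le_one⟩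
  have h11 : (1 : ℝ) ∈ Icc (0 : ℝ) 1 := ⟨zero_le_one, le_rfl⟩
  refine integral_lt_of_le_of_lt_on zero_le_one
    ((integrable_signedPow_descent h (hab.trans hbm.2) hbm h01 h11).continuousOn_mul continuousOn_id)
    ((integrable_signedPow_descent h (hab'.trans hb') hbm' h01 h11).continuousOn_mul continuousOn_id)
    (fun t ht => mul_le_mul_of_nonneg_left (monotone_signedPow h.one_le ?_) ht.1.le)
    hbb hb.le hb' (fun t ht => mul_lt_mul_of_pos_left ?_ (hb.trans ht.1))
  · exact chordTau_mono haa ((strictAntiOn_descent h.one_lt).antitoneOn hbm hbm' hbb.le)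
      (by linarith [h.one_lt, descent_ge h.one_lt hbm']) (hab'.trans hb') ht.1 ht.2.le
  · exact (signedPow_neg (chordTau_neg h.one_lt hab hb ht.1 (ht.2.trans_le hb'))).trans
      (signedPow_pos (chordTau_pos h.one_lt hab' hb' (hb.trans ht.1) ht.2))

end

/-! ### Existence and uniqueness of the solution -/

section

variable {k a b c p : ℝ}

/-- The integrand of `sysF` changes sign from `+` to `-` at `b`, so replacing the weight `t` by the
constant `b` can only increase the integral; with the constant weight it is `b * sysF k p 0 b = 0`.
-/
theorem sysH_zero_neg (h : Admissible k p) (hb : b ∈ Ioo (0 : ℝ) 1) (hF : sysF k p 0 b = 0) :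
    sysH k p 0 b < 0 := by
  have h01 : (0 : ℝ) ∈ Icc (0 : ℝ) 1 := ⟨le_rfl, zero_le_one⟩
  have h11 : (1 : ℝ) ∈ Icc (0 : ℝ) 1 := ⟨zero_le_one, le_rfl⟩
  have hi := integrable_signedPow_descent h zero_le_one ⟨hb.1, hb.2.le⟩ h01 h11
  have hlt : sysH k p 0 b < ∫ t in (0 : ℝ)..1, b * signedPow p (chordTau k 0 (descent k b) t) := by
    refine integral_lt_of_le_of_lt_on zero_le_one (hi.continuousOn_mul continuousOn_id)
      (hi.const_mul b) (fun t ht => ?_) hb.1 le_rfl hb.2.le (fun t ht => ?_)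
    · rcases lt_trichotomy t b with htb | rfl | htb
      · exact mul_le_mul_of_nonneg_right htb.le
          (signedPow_pos (chordTau_pos h.one_lt hb.1.le hb.2.le ht.1 htb)).le
      · exact le_rfl
      · exact mul_le_mul_of_nonpos_right htb.le
          (signedPow_neg (chordTau_neg h.one_lt hb.1.le hb.1 htb ht.2)).le
    · exact mul_lt_mul_of_pos_right ht.2
        (signedPow_pos (chordTau_pos h.one_lt hb.1.le hb.2.le ht.1 ht.2))
  rw [intervalIntegral.integral_const_mul] at hlt
  have : ∫ t in (0 : ℝ)..1, signedPow p (chordTau k 0 (descent k b) t) = 0 := hF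
  rwa [this, mul_zero] at hlt

/-- The zero of `sysF k p a` depends continuously on `a`. -/
theorem continuousOn_of_sysF_eq_zero (h : Admissible k p) {β : ℝ → ℝ}
    (hβ : ∀ a ∈ Ico (0 : ℝ) 1, β a ∈ Ioo a 1) (hF : ∀ a ∈ Ico (0 : ℝ) 1, sysF k p a (β a) = 0) :
    ContinuousOn β (Ico 0 1) := by
  intro a ha
  have hev : ∀ b' ∈ Ioc (0 : ℝ) 1, ContinuousWithinAt (fun a => sysF k p a b') (Ico 0 1) a :=
    fun b' hb' => (continuousOn_sysF_left h hb' a ⟨ha.1, ha.2.le⟩).mono Ico_subset_Icc_self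
  refine tendsto_order.2 ⟨fun y hy => ?_, fun y hy => ?_⟩
  -- At a point `y'` between `y` and `β a` the first integral is negative, and stays so for nearby
  -- `x`; monotonicity in `b` then puts `β x` above `y`. The other half is symmetric.
  · obtain ⟨y', hy1, hy2⟩ : ∃ y', max y a < y' ∧ y' < β a := exists_between (max_lt hy (hβ a ha).1)
    have hy0 : 0 < y' := ha.1.trans_lt ((le_max_right _ _).trans_lt hy1)
    have hy3 : y' < 1 := hy2.trans (hβ a ha).2
    have hneg : sysF k p a y' < 0 := by
      rw [← hF a ha]
      exact sysF_strictMono h ha.1 hy0 hy2 (hβ a ha).2.le (hβ a ha).1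
    filter_upwards [(hev y' ⟨hy0, hy3.le⟩).eventually (gt_mem_nhds hneg), self_mem_nhdsWithin]
      with x hx hxm
    by_contra! hle
    have hlt : β x < y' := hle.trans_lt ((le_max_left _ _).trans_lt hy1)
    have := sysF_strictMono h hxm.1 (hxm.1.trans_lt (hβ x hxm).1) hlt hy3.le
      ((hβ x hxm).1.trans hlt)
    rw [hF x hxm] at this
    linarith
  · obtain ⟨y', hy1, hy2⟩ : ∃ y', β a < y' ∧ y' < min y 1 := exists_between (lt_min hy (hβ a ha).2)
    have hb0 : 0 < β a := ha.1.trans_lt (hβ a ha).1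
    have hy3 : y' < 1 := hy2.trans_le (min_le_right _ _)
    have hpos : 0 < sysF k p a y' := by
      rw [← hF a ha]
      exact sysF_strictMono h ha.1 hb0 hy1 hy3.le ((hβ a ha).1.trans hy1)
    filter_upwards [(hev y' ⟨hb0.trans hy1, hy3.le⟩).eventually (lt_mem_nhds hpos),
      self_mem_nhdsWithin] with x hx hxm
    by_contra! hle
    have hlt : y' < β x := (hy2.trans_le (min_le_left _ _)).trans_le hle
    have := sysF_strictMono h hxm.1 (hb0.trans hy1) hlt (hβ x hxm).2.le (hβ x hxm).1
    rw [hF x hxm] at this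
    linarith

theorem continuousOn_sysH (h : Admissible k p) {β : ℝ → ℝ}
    (hβ : ∀ a ∈ Ico (0 : ℝ) 1, β a ∈ Ioo a 1) (hc : ContinuousOn β (Ico 0 1)) :
    ContinuousOn (fun a => sysH k p a (β a)) (Ico 0 1) := by
  intro a ha
  have hb0 : 0 < β a := ha.1.trans_lt (hβ a ha).1
  refine tendsto_integral_signedPow h (l := 𝓝[Ico 0 1] a) (α := fun a => a)
    (γ := fun a => descent k (β a)) (C := descent k (β a) + 1) (x := 0) (y := 1) (w := fun t => t)
    (u := chordTau k a (descent k (β a))) ⟨le_rfl, zero_le_one⟩ ⟨zero_le_one, le_rfl⟩ measurable_id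
    (fun t ht => by rw [abs_of_pos ht.1]; exact ht.2)
    (by filter_upwards [self_mem_nhdsWithin] with x hx using hx.2.le)
    (descent_bounds h.one_lt (hc a ha) hb0
      (by filter_upwards [self_mem_nhdsWithin] with x hx using (hβ x hx).2.le)) ?_
  filter_upwards [chordTau_ne_zero h.one_lt (hβ a ha).1.le hb0 (hβ a ha).2.le] with t ht htm
  exact ⟨ht htm, tendsto_chordTau (tendsto_id.mono_left nhdsWithin_le_nhds) (hc a ha) hb0 htm.1⟩

/-- As `a → 1` with bounded descent the tent tends to `t`, so `τ` tends to `t^(1-k) - t > 0`. The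
descent itself need not be known to converge. -/
theorem exists_sysH_pos (h : Admissible k p) {β : ℝ → ℝ} {C : ℝ}
    (hβ : ∀ a ∈ Ico (0 : ℝ) 1, β a ∈ Ioo a 1)
    (hC : ∀ a ∈ Ico (0 : ℝ) 1, descent k (β a) ≤ C) :
    ∃ a ∈ Ioo (0 : ℝ) 1, 0 < sysH k p a (β a) := by
  have hmem : ∀ᶠ a in 𝓝[<] (1 : ℝ), a ∈ Ioo (0 : ℝ) 1 := Ioo_mem_nhdsLT one_pos
  have hc0 : ∀ a ∈ Ico (0 : ℝ) 1, 0 ≤ descent k (β a) := fun a ha => by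
    linarith [h.one_lt, descent_ge h.one_lt ⟨ha.1.trans_lt (hβ a ha).1, (hβ a ha).2.le⟩]
  have hu : ∀ t ∈ Ioo (0 : ℝ) 1, 0 < t ^ (1 - k) - t := fun t ht => by
    have := one_le_rpow_one_sub h.one_lt ht.1 ht.2.le
    linarith [ht.2]
  have hlim := tendsto_integral_signedPow h (l := 𝓝[<] (1 : ℝ)) (α := fun a => a)
    (γ := fun a => descent k (β a)) (C := C) (x := 0) (y := 1) (w := fun t => t)
    (u := fun t => t ^ (1 - k) - t) ⟨le_rfl, zero_le_one⟩ ⟨zero_le_one, le_rfl⟩ measurable_id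
    (fun t ht => by rw [abs_of_pos ht.1]; exact ht.2)
    (by filter_upwards [hmem] with x hx using hx.2.le)
    (by filter_upwards [hmem] with x hx using ⟨hc0 x ⟨hx.1.le, hx.2⟩, hC x ⟨hx.1.le, hx.2⟩⟩)
    (Eventually.of_forall fun t ht => ⟨(hu t ht).ne', by
      refine tendsto_const_nhds.sub ?_
      -- Left of the knot the tent equals `t * (1 + (1 + c) * (1/a - 1))`; it is squeezed between
      -- `t` and the same expression with `C` for `c`.
      have hup : Tendsto (fun a : ℝ => t * (1 + (1 + C) * (1 / a - 1))) (𝓝[<] 1) (𝓝 t) := by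
        have : ContinuousAt (fun a : ℝ => t * (1 + (1 + C) * (1 / a - 1))) 1 := by
          fun_prop (disch := norm_num)
        have := this.tendsto.mono_left (nhdsWithin_le_nhds (s := Iio (1 : ℝ)))
        simpa using this
      refine tendsto_of_tendsto_of_tendsto_of_le_of_le' tendsto_const_nhds hup ?_ ?_
      all_goals
        filter_upwards [hmem, Ioo_mem_nhdsLT ht.2] with a ha hat
        have hc := hc0 a ⟨ha.1.le, ha.2⟩
        have hc' := hC a ⟨ha.1.le, ha.2⟩
        have h1 : 1 ≤ 1 / a := by rw [le_div_iff₀ ha.1]; linarith [ha.2]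
        rw [max_eq_left hat.1.le, ← mul_one_div]
      · refine le_mul_of_one_le_right ht.1.le ?_
        nlinarith
      · refine mul_le_mul_of_nonneg_left ?_ ht.1.le
        nlinarith⟩)
  have hpos : 0 < ∫ t in (0 : ℝ)..1, t * signedPow p (t ^ (1 - k) - t) := by
    refine intervalIntegral.intervalIntegral_pos_of_pos_on ?_
      (fun t ht => mul_pos ht.1 (signedPow_pos (hu t ht))) one_pos
    have := integrable_signedPow_chordTau (a := 1) (c := 0) h le_rfl le_rfl
    refine IntervalIntegrable.continuousOn_mul ?_ continuousOn_id
    refine this.congr fun t ht => ?_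
    rw [uIoc_of_le zero_le_one] at ht
    simp [chordTau, max_eq_left ht.2]
  obtain ⟨a, ha, ham⟩ := ((hlim.eventually (lt_mem_nhds hpos)).and hmem).exists
  exact ⟨a, ham, ha⟩

theorem exists_solution (h : Admissible k p) :
    ∃ a b : ℝ, 0 < a ∧ a < b ∧ b < 1 ∧ sysF k p a b = 0 ∧ sysH k p a b = 0 := by
  have hex : ∀ a : ℝ, ∃ b : ℝ, a ∈ Ico (0 : ℝ) 1 → b ∈ Ioo a 1 ∧ sysF k p a b = 0 := by
    intro a
    by_cases ha : a ∈ Ico (0 : ℝ) 1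
    · obtain ⟨b, hb, hF⟩ := exists_sysF_eq_zero h ha.1 ha.2
      exact ⟨b, fun _ => ⟨hb, hF⟩⟩
    · exact ⟨0, fun h' => absurd h' ha⟩
  choose β hβ' using hex
  have hβ : ∀ a ∈ Ico (0 : ℝ) 1, β a ∈ Ioo a 1 := fun a ha => (hβ' a ha).1
  have hF : ∀ a ∈ Ico (0 : ℝ) 1, sysF k p a (β a) = 0 := fun a ha => (hβ' a ha).2
  have h0 : (0 : ℝ) ∈ Ico (0 : ℝ) 1 := ⟨le_rfl, one_pos⟩
  -- `β` is smallest at 0, so the descents along the curve are bounded by the one at `β 0`.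
  have hC : ∀ a ∈ Ico (0 : ℝ) 1, descent k (β a) ≤ descent k (β 0) := by
    intro a ha
    rcases ha.1.eq_or_lt with rfl | ha0
    · exact le_rfl
    · have hlt := lt_of_sysF_eq_zero h le_rfl ha0 (hβ 0 h0).2 (hβ 0 h0).1 (hβ a ha).1 (hF 0 h0) (hF a ha)
      exact (strictAntiOn_descent h.one_lt).antitoneOn ⟨(hβ 0 h0).1, (hβ 0 h0).2.le⟩
        ⟨ha0.trans (hβ a ha).1, (hβ a ha).2.le⟩ hlt.le
  obtain ⟨a1, ha1, hpos⟩ := exists_sysH_pos h hβ hC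
  have hneg := sysH_zero_neg h (hβ 0 h0) (hF 0 h0)
  obtain ⟨a, ha, hH⟩ := intermediate_value_Icc ha1.1.le
    ((continuousOn_sysH h hβ (continuousOn_of_sysF_eq_zero h hβ hF)).mono
      fun x hx => ⟨hx.1, hx.2.trans_lt ha1.2⟩) ⟨hneg.le, hpos.le⟩
  have ham : a ∈ Ico (0 : ℝ) 1 := ⟨ha.1, ha.2.trans_lt ha1.2⟩
  have ha0 : 0 < a := by
    refine lt_of_le_of_ne ha.1 ?_
    rintro rfl
    exact hneg.ne hH
  exact ⟨a, β a, ha0, (hβ a ham).1, (hβ a ham).2, hF a ham, hH⟩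

/-- On the zero set of `sysF`, `b` increases strictly with `a` and `sysH` increases strictly with
them, so two solutions share `a`; then `sysF` determines `b`. -/
theorem solution_unique (h : Admissible k p) {a' b' : ℝ} (ha : 0 < a) (hab : a ≤ b) (hb : b < 1)
    (ha' : 0 < a') (hab' : a' ≤ b') (hb' : b' < 1) (hF : sysF k p a b = 0) (hH : sysH k p a b = 0)
    (hF' : sysF k p a' b' = 0) (hH' : sysH k p a' b' = 0) : a = a' ∧ b = b' := by
  have hlt : ∀ {a b : ℝ}, 0 < a → a ≤ b → b < 1 → sysF k p a b = 0 → a < b := by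
    intro a b ha hab hb hF
    refine lt_of_le_of_ne hab ?_
    rintro rfl
    exact (sysF_self_neg h ha hb).ne hF
  have key : ∀ {a b a' b' : ℝ}, 0 < a → a ≤ b → b < 1 → 0 < a' → a' ≤ b' → b' < 1 →
      sysF k p a b = 0 → sysH k p a b = 0 → sysF k p a' b' = 0 → sysH k p a' b' = 0 → ¬ a < a' := by
    intro a b a' b' ha hab hb ha' hab' hb' hF hH hF' hH' haa
    have hbb := lt_of_sysF_eq_zero h ha.le haa hb (hlt ha hab hb hF) (hlt ha' hab' hb' hF') hF hF'
    have := sysH_lt h haa.le hab (ha.trans_le hab) hbb hab' hb'.le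
    linarith
  have haa : a = a' := le_antisymm (not_lt.1 (key ha' hab' hb' ha hab hb hF' hH' hF hH))
    (not_lt.1 (key ha hab hb ha' hab' hb' hF hH hF' hH'))
  subst haa
  refine ⟨rfl, ?_⟩
  rcases lt_trichotomy b b' with hlt' | h' | hlt'
  · have := sysF_strictMono h ha.le (ha.trans_le hab) hlt' hb'.le (hab.trans_lt hlt')
    linarith
  · exact h'
  · have := sysF_strictMono h ha.le (ha.trans_le hab') hlt' hb.le (hab'.trans_lt hlt')
    linarith

/-! ### The functions of the statement in terms of `chordTau` -/

theorem integral_omega_mid {x y : ℝ} (ha : a ∈ Ioo (0 : ℝ) 1) (hb : b ∈ Ioo (0 : ℝ) 1)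
    (hx : a ≤ x) (hxy : x ≤ y) (hy : y ≤ 1) :
    IntervalIntegrable (omega k a b) volume x y ∧
      ∫ t in x..y, omega k a b t = -descent k b * (y - x) := by
  have e : EqOn (fun _ => -descent k b) (omega k a b) (uIoo x y) := by
    intro t ht
    rw [uIoo_of_le hxy] at ht
    have h1 : 1 - b ≠ 0 := by linarith [hb.2]
    have h2 : a < t := hx.trans_lt ht.1
    simp only [omega]
    rw [if_neg (not_le.2 (ha.1.trans h2)), if_neg (not_le.2 h2), if_pos (ht.2.trans_le hy),
      descent_of_ne hb.2.ne]
    field_simp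
    ring
  refine ⟨(intervalIntegrable_const (c := -descent k b)).congr_uIoo e, ?_⟩
  rw [← intervalIntegral.integral_congr_uIoo e]
  simp
  ring

theorem integral_omega_right {y : ℝ} (ha : a ∈ Ioo (0 : ℝ) 1) (hy : 1 ≤ y) :
    IntervalIntegrable (omega k a b) volume 1 y ∧
      ∫ t in (1 : ℝ)..y, omega k a b t = y ^ (1 - k) - 1 := by
  have h0 : (0 : ℝ) ∉ uIcc 1 y := by
    rw [uIcc_of_le hy]
    exact fun h => by linarith [h.1]
  have e : EqOn (fun t => (1 - k) * t ^ (-k)) (omega k a b) (uIoo 1 y) := by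
    intro t ht
    rw [uIoo_of_le hy] at ht
    simp only [omega]
    rw [if_neg (by linarith [ht.1]), if_neg (by linarith [ht.1, ha.2]), if_neg (by linarith [ht.1])]
  have hi : IntervalIntegrable (fun t : ℝ => (1 - k) * t ^ (-k)) volume 1 y :=
    (intervalIntegral.intervalIntegrable_rpow (Or.inr h0)).const_mul _
  refine ⟨hi.congr_uIoo e, ?_⟩
  rw [← intervalIntegral.integral_congr_uIoo e, intervalIntegral.integral_eq_sub_of_hasDerivAt
    (f := fun t : ℝ => t ^ (1 - k)) (fun t ht => ?_) hi, Real.one_rpow]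
  rw [uIcc_of_le hy] at ht
  have := Real.hasDerivAt_rpow_const (p := 1 - k) (Or.inl (by linarith [ht.1] : t ≠ 0))
  rwa [show 1 - k - 1 = -k by ring] at this

theorem integral_omega_left (ha : a ∈ Ioo (0 : ℝ) 1) (hb : b ∈ Ioo (0 : ℝ) 1) {t : ℝ} (ht : 0 ≤ t)
    (hta : t ≤ a) : IntervalIntegrable (omega k a b) volume 0 t ∧
      ∫ x in (0 : ℝ)..t, omega k a b x = t * ((1 + descent k b) / a - descent k b) := by
  have e : EqOn (fun _ => (1 + descent k b) / a - descent k b) (omega k a b) (uIoo 0 t) := by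
    intro x hx
    rw [uIoo_of_le ht] at hx
    have h1 : 1 - b ≠ 0 := by linarith [hb.2]
    have h2 : a ≠ 0 := ha.1.ne'
    simp only [omega]
    rw [if_neg (not_le.2 hx.1), if_pos (hx.2.le.trans hta), descent_of_ne hb.2.ne]
    field_simp
    ring
  refine ⟨(intervalIntegrable_const (c := (1 + descent k b) / a - descent k b)).congr_uIoo e, ?_⟩
  rw [← intervalIntegral.integral_congr_uIoo e]
  simp
  ring

theorem omegaInt_of_mem (ha : a ∈ Ioo (0 : ℝ) 1) (hb : b ∈ Ioo (0 : ℝ) 1) {t : ℝ}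
    (ht : t ∈ Ioc (0 : ℝ) 1) :
    IntervalIntegrable (omega k a b) volume 0 t ∧
      omegaInt k a b t = t * ((1 + descent k b) / max a t - descent k b) := by
  rcases le_or_gt t a with hta | hta
  · obtain ⟨i, e⟩ := integral_omega_left (k := k) ha hb ht.1.le hta
    exact ⟨i, by rw [omegaInt, e, max_eq_left hta]⟩
  · obtain ⟨i1, e1⟩ := integral_omega_left (k := k) ha hb ha.1.le le_rfl
    obtain ⟨i2, e2⟩ := integral_omega_mid (k := k) ha hb le_rfl hta.le ht.2
    refine ⟨i1.trans i2, ?_⟩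
    rw [omegaInt, ← intervalIntegral.integral_add_adjacent_intervals i1 i2, e1, e2,
      max_eq_right hta.le]
    have h1 : a ≠ 0 := ha.1.ne'
    have h2 : t ≠ 0 := ht.1.ne'
    field_simp
    ring

theorem gamma_mul_R (hk : k < 2) {t : ℝ} (ht : 0 < t) :
    Real.Gamma (2 - k) * R (2 - k) t = t ^ (1 - k) := by
  have : Real.Gamma (2 - k) ≠ 0 := (Real.Gamma_pos_of_pos (by linarith)).ne'
  rw [R, if_pos ht]
  field_simp
  congr 1
  ring

theorem tau_eq_chordTau (hk : k < 2) (ha : a ∈ Ioo (0 : ℝ) 1) (hb : b ∈ Ioo (0 : ℝ) 1) {t : ℝ}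
    (ht : t ∈ Ioc (0 : ℝ) 1) : tau k a b t = chordTau k a (descent k b) t := by
  rw [tau, gamma_mul_R hk ht.1, (omegaInt_of_mem ha hb ht).2, chordTau]

/-- On `[1, ∞)` the function `ω` is the derivative of `x^(1-k)`, and the tent already has the value
1 at 1. -/
theorem tau_eq_zero_of_ge (hk : k < 2) (ha : a ∈ Ioo (0 : ℝ) 1) (hb : b ∈ Ioo (0 : ℝ) 1) {t : ℝ}
    (ht : 1 ≤ t) : tau k a b t = 0 := by
  obtain ⟨i1, e1⟩ := omegaInt_of_mem (k := k) ha hb ⟨one_pos, le_rfl⟩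
  obtain ⟨i2, e2⟩ := integral_omega_right (k := k) (b := b) ha ht
  rw [omegaInt, max_eq_right ha.2.le] at e1
  rw [tau, gamma_mul_R hk (by linarith), omegaInt,
    ← intervalIntegral.integral_add_adjacent_intervals i1 i2, e1, e2]
  simp

theorem tau_eq_zero_of_nonpos {t : ℝ} (ht : t ≤ 0) : tau k a b t = 0 := by
  have e : EqOn (omega k a b) (fun _ => 0) (uIoo 0 t) := by
    intro x hx
    rw [uIoo_of_ge ht] at hx
    simp only [omega]
    rw [if_pos hx.2.le]
  rw [tau, omegaInt, intervalIntegral.integral_congr_uIoo e, R, if_neg (not_lt.2 ht)]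
  simp

variable {s : ℝ≥0∞}

theorem tauPow_eq (hk : k < 2) (ha : a ∈ Ioo (0 : ℝ) 1) (hb : b ∈ Ioo (0 : ℝ) 1) {t : ℝ}
    (ht : t ∈ Ioc (0 : ℝ) 1) :
    tauPow s k a b t = signedPow (conjExp s) (chordTau k a (descent k b) t) := by
  rw [tauPow, tau_eq_chordTau hk ha hb ht, signedPow]

theorem tauPow_eq_zero_of_ge (hk : k < 2) (ha : a ∈ Ioo (0 : ℝ) 1) (hb : b ∈ Ioo (0 : ℝ) 1) {t : ℝ}
    (ht : 1 ≤ t) : tauPow s k a b t = 0 := by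
  rw [tauPow, tau_eq_zero_of_ge hk ha hb ht, Real.sign_zero, mul_zero]

theorem tauPow_eq_zero_of_nonpos {t : ℝ} (ht : t ≤ 0) : tauPow s k a b t = 0 := by
  rw [tauPow, tau_eq_zero_of_nonpos ht, Real.sign_zero, mul_zero]

theorem lt_two_of_lt (hks : k < 2 - 1 / s.toReal) : k < 2 := by
  linarith [one_div_toReal_nonneg s]

theorem isSolution_iff (hks : k < 2 - 1 / s.toReal) :
    IsSolution s k (a, b) ↔ (a ∈ Ioo (0 : ℝ) 1 ∧ b ∈ Ioo (0 : ℝ) 1 ∧ a ≤ b) ∧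
      sysF k (conjExp s) a b = 0 ∧ sysH k (conjExp s) a b = 0 := by
  unfold IsSolution M
  simp only [mem_ofPred_eq]
  refine and_congr_right fun ⟨ha, hb, hab⟩ => ?_
  have hk2 := lt_two_of_lt hks
  -- On `(a, 1)` the kernel does not see the knot, which is why `sysF` may use the knot 0.
  have e1 : ∫ t in a..1, tauPow s k a b t = sysF k (conjExp s) a b := by
    refine intervalIntegral.integral_congr_uIoo fun t ht => ?_
    rw [uIoo_of_le ha.2.le] at ht
    have ht0 := ha.1.trans ht.1
    rw [tauPow_eq hk2 ha hb ⟨ht0, ht.2.le⟩, chordTau_of_ge ht0 ht.1.le, chordTau_of_ge ht0 ht0.le]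
  have e2 : ∫ t in (0 : ℝ)..1, t * tauPow s k a b t = sysH k (conjExp s) a b := by
    refine intervalIntegral.integral_congr_uIoo fun t ht => ?_
    rw [uIoo_of_le zero_le_one] at ht
    rw [tauPow_eq hk2 ha hb ⟨ht.1, ht.2.le⟩]
  rw [e1, e2]

theorem existsUnique_isSolution (hs : 1 < s) (hk : 1 < k) (hks : k < 2 - 1 / s.toReal) :
    ∃! q : ℝ × ℝ, IsSolution s k q := by
  have h := Admissible.of_space hs hk hks
  obtain ⟨a, b, ha, hab, hb, hF, hH⟩ := exists_solution h
  refine ⟨(a, b), (isSolution_iff hks).2 ⟨⟨⟨ha, hab.trans hb⟩, ⟨ha.trans hab, hb⟩, hab.le⟩, hF, hH⟩, ?_⟩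
  rintro ⟨a', b'⟩ hq
  obtain ⟨⟨ha', hb', hab'⟩, hF', hH'⟩ := (isSolution_iff hks).1 hq
  obtain ⟨rfl, rfl⟩ := solution_unique h ha hab.le hb ha'.1 hab' hb'.2 hF hH hF' hH'
  rfl

end

/-! ### The extremal function -/

section

variable {s : ℝ≥0∞} {k a b c : ℝ}

/-- The parameters of the extremal function: a solution of the system, with admissible exponents. -/
structure Extremal (s : ℝ≥0∞) (k a b : ℝ) : Prop where
  one_lt_s : 1 < s
  one_lt : 1 < k
  lt : k < 2 - 1 / s.toReal
  mem_a : a ∈ Ioo (0 : ℝ) 1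
  mem_b : b ∈ Ioo (0 : ℝ) 1
  le : a ≤ b
  int_eq : ∫ t in a..1, tauPow s k a b t = 0
  int_mul_eq : ∫ t in (0 : ℝ)..1, t * tauPow s k a b t = 0

theorem Extremal.of_isSolution (hs : 1 < s) (hk : 1 < k) (hks : k < 2 - 1 / s.toReal)
    (h : IsSolution s k (a, b)) : Extremal s k a b :=
  ⟨hs, hk, hks, h.1.1, h.1.2.1, h.1.2.2, h.2.1, h.2.2⟩

theorem Extremal.admissible (h : Extremal s k a b) : Admissible k (conjExp s) :=
  Admissible.of_space h.one_lt_s h.one_lt h.lt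

theorem Extremal.lt_two (h : Extremal s k a b) : k < 2 := lt_two_of_lt h.lt

theorem Extremal.descent_nonneg (h : Extremal s k a b) : 0 ≤ descent k b := by
  linarith [h.one_lt, descent_ge h.one_lt ⟨h.mem_b.1, h.mem_b.2.le⟩]

theorem Extremal.tauPow_eq_indicator (h : Extremal s k a b) :
    tauPow s k a b =
      (Ioc 0 1).indicator fun t => signedPow (conjExp s) (chordTau k a (descent k b) t) := by
  ext t
  by_cases ht : t ∈ Ioc (0 : ℝ) 1
  · rw [indicator_of_mem ht, tauPow_eq h.lt_two h.mem_a h.mem_b ht]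
  · rw [indicator_of_notMem ht]
    rcases le_or_gt t 0 with h0 | h0
    · exact tauPow_eq_zero_of_nonpos h0
    · exact tauPow_eq_zero_of_ge h.lt_two h.mem_a h.mem_b (by
        by_contra! h1; exact ht ⟨h0, h1.le⟩)

theorem Extremal.integrable_tauPow (h : Extremal s k a b) : Integrable (tauPow s k a b) := by
  rw [h.tauPow_eq_indicator, integrable_indicator_iff measurableSet_Ioc,
    ← intervalIntegrable_iff_integrableOn_Ioc_of_le zero_le_one]
  exact integrable_signedPow_chordTau h.admissible h.mem_a.2.le h.descent_nonneg

theorem Extremal.intervalIntegrable (h : Extremal s k a b) (x y : ℝ) :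
    IntervalIntegrable (tauPow s k a b) volume x y := h.integrable_tauPow.intervalIntegrable

theorem Extremal.tauPow_pos (h : Extremal s k a b) {t : ℝ} (ht : 0 < t) (htb : t < b) :
    0 < tauPow s k a b t := by
  rw [tauPow_eq h.lt_two h.mem_a h.mem_b ⟨ht, (htb.trans h.mem_b.2).le⟩]
  exact signedPow_pos (chordTau_pos h.one_lt h.le h.mem_b.2.le ht htb)

theorem Extremal.tauPow_nonpos (h : Extremal s k a b) {t : ℝ} (htb : b < t) :
    tauPow s k a b t ≤ 0 := by
  rcases lt_or_ge t 1 with h1 | h1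
  · rw [tauPow_eq h.lt_two h.mem_a h.mem_b ⟨h.mem_b.1.trans htb, h1.le⟩]
    exact (signedPow_neg (chordTau_neg h.one_lt h.le h.mem_b.1 htb h1)).le
  · rw [tauPow_eq_zero_of_ge h.lt_two h.mem_a h.mem_b h1]

theorem Extremal.continuous_primitive (h : Extremal s k a b) (c : ℝ) :
    Continuous fun x => ∫ t in c..x, tauPow s k a b t :=
  intervalIntegral.continuous_primitive (fun x y => h.intervalIntegrable x y) c

theorem Extremal.integral_id_mul (h : Extremal s k a b) (x : ℝ) :
    ∫ t in (0 : ℝ)..x, t * tauPow s k a b t =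
      x * (∫ t in (0 : ℝ)..x, tauPow s k a b t) -
        ∫ u in (0 : ℝ)..x, ∫ t in (0 : ℝ)..u, tauPow s k a b t := by
  have h1 : AbsolutelyContinuousOnInterval (fun t : ℝ => t) 0 x :=
    contDiff_id.contDiffOn.absolutelyContinuousOnInterval
  have h2 := (h.intervalIntegrable 0 x).absolutelyContinuousOnInterval_intervalIntegral
    (c := 0) (by simp)
  have key := h1.integral_mul_deriv_eq_deriv_mul h2
  have e : ∫ t in (0 : ℝ)..x, t * tauPow s k a b t =
      ∫ t in (0 : ℝ)..x, t * deriv (fun x => ∫ t in (0 : ℝ)..x, tauPow s k a b t) t := by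
    apply intervalIntegral.integral_congr_ae
    filter_upwards [(h.intervalIntegrable 0 x).ae_hasDerivAt_integral] with t ht htm
    rw [(ht (uIoc_subset_uIcc htm) 0 (by simp)).deriv]
  rw [e, key]
  simp

/-- `φ` as `φ 0` plus the primitive of `x ↦ ∫_a^x τ_{(s')}`, which exhibits `φ'` and shows `φ' a =
0`. -/
theorem Extremal.phi_eq (h : Extremal s k a b) (x : ℝ) :
    phi s k a b x = (∫ t in (0 : ℝ)..a, t / 2 * tauPow s k a b t) +
      ∫ u in (0 : ℝ)..x, ∫ t in a..u, tauPow s k a b t := by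
  have i0 := h.intervalIntegrable 0 a
  have i1 : IntervalIntegrable (fun t => t / 2 * tauPow s k a b t) volume 0 a :=
    i0.continuousOn_mul (by fun_prop)
  have i2 : IntervalIntegrable (fun t => t * tauPow s k a b t) volume 0 x :=
    (h.intervalIntegrable 0 x).continuousOn_mul continuousOn_id
  have e1 : ∫ t in (0 : ℝ)..a, (-x + t / 2) * tauPow s k a b t =
      -x * (∫ t in (0 : ℝ)..a, tauPow s k a b t) + ∫ t in (0 : ℝ)..a, t / 2 * tauPow s k a b t := by
    rw [← intervalIntegral.integral_const_mul, ← intervalIntegral.integral_add (i0.const_mul _) i1]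
    congr 1; ext t; ring
  have e2 : ∫ t in (0 : ℝ)..x, (x - t) * tauPow s k a b t =
      x * (∫ t in (0 : ℝ)..x, tauPow s k a b t) - ∫ t in (0 : ℝ)..x, t * tauPow s k a b t := by
    rw [← intervalIntegral.integral_const_mul,
      ← intervalIntegral.integral_sub ((h.intervalIntegrable 0 x).const_mul _) i2]
    congr 1; ext t; ring
  have e3 : ∫ u in (0 : ℝ)..x, ∫ t in a..u, tauPow s k a b t =
      (∫ u in (0 : ℝ)..x, ∫ t in (0 : ℝ)..u, tauPow s k a b t) -
        x * ∫ t in (0 : ℝ)..a, tauPow s k a b t := by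
    have : ∀ u : ℝ, ∫ t in a..u, tauPow s k a b t =
        (∫ t in (0 : ℝ)..u, tauPow s k a b t) - ∫ t in (0 : ℝ)..a, tauPow s k a b t := fun u =>
      (intervalIntegral.integral_interval_sub_left (h.intervalIntegrable 0 u) i0).symm
    simp only [this]
    rw [intervalIntegral.integral_sub ((h.continuous_primitive 0).intervalIntegrable _ _)
      intervalIntegrable_const]
    simp
  rw [phi, e1, e2, h.integral_id_mul, e3]
  ring

theorem Extremal.hasDerivAt_phi (h : Extremal s k a b) (x : ℝ) :
    HasDerivAt (phi s k a b) (∫ t in a..x, tauPow s k a b t) x := by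
  rw [funext h.phi_eq]
  exact ((h.continuous_primitive a).integral_hasStrictDerivAt 0 x).hasDerivAt.const_add _

theorem Extremal.d1_phi (h : Extremal s k a b) {x : ℝ} (hx : 0 ≤ x) :
    d1 (phi s k a b) x = ∫ t in a..x, tauPow s k a b t :=
  (h.hasDerivAt_phi x).hasDerivWithinAt.derivWithin (uniqueDiffOn_Ici 0 x hx)

theorem Extremal.d2_phi (h : Extremal s k a b) : d2 (phi s k a b) =ᵐ[vol] tauPow s k a b := by
  rw [vol, EventuallyEq, ae_restrict_iff' measurableSet_Ici]
  filter_upwards [LocallyIntegrable.ae_hasDerivAt_integral h.integrable_tauPow.locallyIntegrable] with x hx hxm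
  have := (hx a).hasDerivWithinAt (s := Ici 0)
  exact (this.congr (fun y hy => h.d1_phi hy) (h.d1_phi hxm)).derivWithin (uniqueDiffOn_Ici 0 x hxm)

theorem Extremal.absolutelyContinuous_d1 (h : Extremal s k a b) {c : ℝ} (hc : 0 < c) :
    AbsolutelyContinuousOnInterval (d1 (phi s k a b)) 0 c := by
  have h1 : AbsolutelyContinuousOnInterval
      (fun _ : ℝ => ∫ t in a..(0 : ℝ), tauPow s k a b t) 0 c :=
    contDiffOn_const.absolutelyContinuousOnInterval
  have h2 := (h.intervalIntegrable 0 c).absolutelyContinuousOnInterval_intervalIntegral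
    (c := 0) (by simp)
  refine absolutelyContinuous_congr (h1.fun_add h2) fun x hx => ?_
  rw [uIcc_of_le hc.le] at hx
  rw [h.d1_phi hx.1, intervalIntegral.integral_add_adjacent_intervals (h.intervalIntegrable _ _)
    (h.intervalIntegrable _ _)]

/-! ### Alternation and sup norm of `φ` -/

theorem Extremal.phi_zero (h : Extremal s k a b) :
    phi s k a b 0 = ∫ t in (0 : ℝ)..a, t / 2 * tauPow s k a b t := by
  rw [h.phi_eq]; simp

theorem Extremal.phi_zero_pos (h : Extremal s k a b) : 0 < phi s k a b 0 := by
  rw [h.phi_zero]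
  refine intervalIntegral.intervalIntegral_pos_of_pos_on
    ((h.intervalIntegrable 0 a).continuousOn_mul (by fun_prop)) (fun t ht => ?_) h.mem_a.1
  exact mul_pos (by linarith [ht.1]) (h.tauPow_pos ht.1 (ht.2.trans_le h.le))

/-- The additive constant of `φ` is chosen for this: `(-a + t/2) + (a - t) = -t/2`. -/
theorem Extremal.phi_knot (h : Extremal s k a b) : phi s k a b a = -phi s k a b 0 := by
  have i1 : IntervalIntegrable (fun t => (-a + t / 2) * tauPow s k a b t) volume 0 a :=
    (h.intervalIntegrable 0 a).continuousOn_mul (by fun_prop)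
  have i2 : IntervalIntegrable (fun t => (a - t) * tauPow s k a b t) volume 0 a :=
    (h.intervalIntegrable 0 a).continuousOn_mul (by fun_prop)
  rw [h.phi_zero, phi, ← intervalIntegral.integral_add i1 i2, ← intervalIntegral.integral_neg]
  congr 1; ext t; ring

/-- The difference of the two sides is `∫_a^1 τ_{(s')} - ∫_0^1 t τ_{(s')}`, and both vanish by the
system. -/
theorem Extremal.phi_one (h : Extremal s k a b) : phi s k a b 1 = phi s k a b 0 := by
  have i0 := h.intervalIntegrable 0 a
  have i1 : IntervalIntegrable (fun t => t / 2 * tauPow s k a b t) volume 0 a :=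
    i0.continuousOn_mul (by fun_prop)
  have i2 : IntervalIntegrable (fun t => t * tauPow s k a b t) volume 0 1 :=
    (h.intervalIntegrable 0 1).continuousOn_mul continuousOn_id
  have e1 : ∫ t in (0 : ℝ)..a, (-1 + t / 2) * tauPow s k a b t =
      (∫ t in (0 : ℝ)..a, t / 2 * tauPow s k a b t) - ∫ t in (0 : ℝ)..a, tauPow s k a b t := by
    rw [← intervalIntegral.integral_sub i1 i0]
    congr 1; ext t; ring
  have e2 : ∫ t in (0 : ℝ)..1, (1 - t) * tauPow s k a b t =
      (∫ t in (0 : ℝ)..1, tauPow s k a b t) - ∫ t in (0 : ℝ)..1, t * tauPow s k a b t := by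
    rw [← intervalIntegral.integral_sub (h.intervalIntegrable 0 1) i2]
    congr 1; ext t; ring
  rw [h.phi_zero, phi, e1, e2, h.int_mul_eq,
    ← intervalIntegral.integral_add_adjacent_intervals i0 (h.intervalIntegrable a 1), h.int_eq]
  ring

theorem Extremal.integral_eq_zero (h : Extremal s k a b) {x y : ℝ} (hx : 1 ≤ x) (hxy : x ≤ y) :
    ∫ t in x..y, tauPow s k a b t = 0 := by
  have e : EqOn (tauPow s k a b) (fun _ => 0) (uIoo x y) := fun t ht => by
    rw [uIoo_of_le hxy] at ht
    exact tauPow_eq_zero_of_ge h.lt_two h.mem_a h.mem_b (hx.trans ht.1.le)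
  rw [intervalIntegral.integral_congr_uIoo e]; simp

theorem Extremal.deriv_nonpos (h : Extremal s k a b) {x : ℝ} (hx : 0 ≤ x) (hxa : x ≤ a) :
    ∫ t in a..x, tauPow s k a b t ≤ 0 := by
  rw [intervalIntegral.integral_symm, neg_nonpos]
  refine intervalIntegral.integral_nonneg hxa fun t ht => ?_
  rcases (hx.trans ht.1).eq_or_lt with rfl | h0
  · rw [tauPow_eq_zero_of_nonpos le_rfl]
  rcases lt_or_ge t b with hb | hb
  · exact (h.tauPow_pos h0 hb).le
  -- This case occurs only for `t = a = b`, where `τ` vanishes.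
  · have : t = b := le_antisymm (ht.2.trans h.le) hb
    rw [this, tauPow_eq h.lt_two h.mem_a h.mem_b ⟨h.mem_b.1, h.mem_b.2.le⟩,
      chordTau_of_ge h.mem_b.1 h.le, sub_self, mul_zero, signedPow_zero]

/-- Up to `b` the integrand is positive. Beyond `b` the integral is minus the one over the rest,
because the total over `(a, 1)` is 0, and there the integrand is nonpositive. The bound `max x 1`
also covers `x > 1`. -/
theorem Extremal.deriv_nonneg (h : Extremal s k a b) {x : ℝ} (hxa : a ≤ x) :
    0 ≤ ∫ t in a..x, tauPow s k a b t := by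
  rcases le_or_gt x b with hb | hb
  · have := intervalIntegral.integral_mono_on_of_le_Ioo hxa
      (intervalIntegrable_const (c := (0 : ℝ))) (h.intervalIntegrable a x)
      fun t ht => (h.tauPow_pos (h.mem_a.1.trans ht.1) (ht.2.trans_le hb)).le
    simpa using this
  · have h1 : ∫ t in a..x, tauPow s k a b t = -∫ t in x..max x 1, tauPow s k a b t := by
      have e1 := intervalIntegral.integral_add_adjacent_intervals (h.intervalIntegrable a x)
        (h.intervalIntegrable x (max x 1))
      have e2 := intervalIntegral.integral_add_adjacent_intervals (h.intervalIntegrable a 1)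
        (h.intervalIntegrable 1 (max x 1))
      rw [h.int_eq, h.integral_eq_zero le_rfl (le_max_right _ _)] at e2
      linarith
    rw [h1, neg_nonneg]
    have := intervalIntegral.integral_mono_on_of_le_Ioo (le_max_left x 1)
      (h.intervalIntegrable x (max x 1)) (intervalIntegrable_const (c := (0 : ℝ)))
      fun t ht => h.tauPow_nonpos (hb.trans ht.1)
    simpa using this

theorem Extremal.phi_of_ge (h : Extremal s k a b) {x : ℝ} (hx : 1 ≤ x) :
    phi s k a b x = phi s k a b 0 := by
  have hc := h.continuous_primitive a
  rw [← h.phi_one, h.phi_eq, h.phi_eq, ← intervalIntegral.integral_add_adjacent_intervals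
    (hc.intervalIntegrable 0 1) (hc.intervalIntegrable 1 x)]
  have : EqOn (fun u => ∫ t in a..u, tauPow s k a b t) (fun _ => 0) (uIoo 1 x) := fun u hu => by
    rw [uIoo_of_le hx] at hu
    simp only
    rw [← intervalIntegral.integral_add_adjacent_intervals (h.intervalIntegrable a 1)
      (h.intervalIntegrable 1 u), h.int_eq, h.integral_eq_zero le_rfl hu.1.le, add_zero]
  rw [intervalIntegral.integral_congr_uIoo this]
  simp

/-- `φ` decreases from `φ 0` to `-φ 0` on `[0, a]`, then increases to `φ 0`, which it keeps from 1
on. -/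
theorem Extremal.abs_phi_le (h : Extremal s k a b) {x : ℝ} (hx : 0 ≤ x) :
    |phi s k a b x| ≤ phi s k a b 0 := by
  have hcont : Continuous (phi s k a b) :=
    continuous_iff_continuousAt.2 fun x => (h.hasDerivAt_phi x).continuousAt
  have hanti : AntitoneOn (phi s k a b) (Icc 0 a) := by
    refine antitoneOn_of_deriv_nonpos (convex_Icc 0 a) hcont.continuousOn
      (fun x _ => (h.hasDerivAt_phi x).differentiableAt.differentiableWithinAt) fun x hx => ?_
    rw [interior_Icc] at hx
    rw [(h.hasDerivAt_phi x).deriv]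
    exact h.deriv_nonpos hx.1.le hx.2.le
  have hmono : MonotoneOn (phi s k a b) (Ici a) := by
    refine monotoneOn_of_deriv_nonneg (convex_Ici a) hcont.continuousOn
      (fun x _ => (h.hasDerivAt_phi x).differentiableAt.differentiableWithinAt) fun x hx => ?_
    rw [interior_Ici] at hx
    rw [(h.hasDerivAt_phi x).deriv]
    exact h.deriv_nonneg (le_of_lt hx)
  have ha := h.mem_a.1.le
  have hk := h.phi_knot
  rw [abs_le]
  rcases le_or_gt x a with hxa | hxa
  · have h1 := hanti ⟨le_rfl, ha⟩ ⟨hx, hxa⟩ hx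
    have h2 := hanti ⟨hx, hxa⟩ ⟨ha, le_rfl⟩ hxa
    constructor <;> linarith
  · have h1 := hmono (mem_Ici.2 le_rfl) (mem_Ici.2 hxa.le) hxa.le
    have h2 := hmono (mem_Ici.2 hxa.le) (mem_Ici.2 (hxa.le.trans (le_max_left x 1))) (le_max_left x 1)
    rw [h.phi_of_ge (le_max_right x 1)] at h2
    constructor <;> linarith

/-- The integral `∫ |τ|^{s'}`. -/
noncomputable def energy (s : ℝ≥0∞) (k a b : ℝ) : ℝ :=
  ∫ t in (0 : ℝ)..1, |chordTau k a (descent k b) t| ^ conjExp s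

theorem Extremal.integrable_energy (h : Extremal s k a b) : IntervalIntegrable
    (fun t => |chordTau k a (descent k b) t| ^ conjExp s) volume 0 1 := by
  rw [intervalIntegrable_iff_integrableOn_Ioc_of_le zero_le_one]
  have := (memLp_chordTau h.one_lt_s h.one_lt h.lt h.mem_a.2.le h.descent_nonneg).integrable_norm_rpow'
  rwa [ENNReal.toReal_ofReal (by linarith [conjExp_ge_one h.one_lt_s])] at this

theorem Extremal.energy_pos (h : Extremal s k a b) : 0 < energy s k a b := by
  have hpos : 0 < ∫ t in (0 : ℝ)..b, |chordTau k a (descent k b) t| ^ conjExp s := by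
    refine intervalIntegral.intervalIntegral_pos_of_pos_on (h.integrable_energy.mono_set ?_)
      (fun t ht => ?_) h.mem_b.1
    · rw [uIcc_of_le h.mem_b.1.le, uIcc_of_le zero_le_one]
      exact Icc_subset_Icc_right h.mem_b.2.le
    · exact Real.rpow_pos_of_pos
        (abs_pos.2 (chordTau_pos h.one_lt h.le h.mem_b.2.le ht.1 ht.2).ne') _
  refine hpos.trans_le (intervalIntegral.integral_mono_interval le_rfl h.mem_b.1.le h.mem_b.2.le
    (Eventually.of_forall fun t => by positivity) h.integrable_energy)

/-- The equality case of Hölder: `energy` is the product of its powers `1 - 1/s` and `1/s`, which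
are the norms of `τ` and `τ_{(s')}`. -/
theorem Extremal.integral_mul_tauPow (h : Extremal s k a b) :
    ∫ t in (0 : ℝ)..1, chordTau k a (descent k b) t * tauPow s k a b t = energy s k a b := by
  refine intervalIntegral.integral_congr_uIoo fun t ht => ?_
  rw [uIoo_of_le zero_le_one] at ht
  rw [tauPow_eq h.lt_two h.mem_a h.mem_b ⟨ht.1, ht.2.le⟩,
    mul_signedPow (conjExp_ge_one h.one_lt_s)]

/-- For finite `s` this is `(s' - 1) s = s'`. For `s = ∞` the power is the sign of `τ`, of modulus 1
almost everywhere on `(0, 1)` since `τ` vanishes there only at `b`. -/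
theorem Extremal.eLpNorm_tauPow (h : Extremal s k a b) :
    eLpNorm (tauPow s k a b) s vol = ENNReal.ofReal (energy s k a b ^ (1 / s.toReal)) := by
  have hne := chordTau_ne_zero h.one_lt h.le h.mem_b.1 h.mem_b.2.le
  have hsub : Ioc (0 : ℝ) 1 ⊆ Ici 0 := fun t ht => ht.1.le
  have e1 : eLpNorm (tauPow s k a b) s vol =
      eLpNorm (fun t => |chordTau k a (descent k b) t| ^ (conjExp s - 1)) s
        (volume.restrict (Ioc 0 1)) := by
    rw [h.tauPow_eq_indicator, eLpNorm_indicator_eq_eLpNorm_restrict measurableSet_Ioc, vol,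
      Measure.restrict_restrict measurableSet_Ioc, inter_eq_left.2 hsub]
    refine eLpNorm_congr_norm_ae ?_
    rw [ae_restrict_iff' measurableSet_Ioc]
    filter_upwards [hne, Measure.ae_ne volume 1] with t ht ht1 htm
    rw [Real.norm_eq_abs, abs_signedPow_of_ne (ht ⟨htm.1, lt_of_le_of_ne htm.2 ht1⟩),
      Real.norm_of_nonneg (by positivity)]
  rw [e1]
  rcases eq_or_ne s ∞ with rfl | hs
  · have e : ∀ t, |chordTau k a (descent k b) t| ^ (conjExp ∞ - 1) = 1 := fun t => by
      simp [conjExp]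
    simp only [e]
    rw [eLpNorm_const _ (by simp) (by simp)]
    simp
  · have hs0 : s ≠ 0 := (zero_lt_one.trans h.one_lt_s).ne'
    have hr : 1 < s.toReal := by
      rw [← ENNReal.toReal_one]
      exact (ENNReal.toReal_lt_toReal (by simp) hs).2 h.one_lt_s
    have hexp : (conjExp s - 1) * s.toReal = conjExp s := by
      have : s.toReal - 1 ≠ 0 := by linarith
      rw [conjExp]; field_simp; ring
    have e2 : ∀ t, ‖|chordTau k a (descent k b) t| ^ (conjExp s - 1)‖ ^ s.toReal =
        |chordTau k a (descent k b) t| ^ conjExp s := fun t => by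
      rw [Real.norm_of_nonneg (by positivity), ← Real.rpow_mul (abs_nonneg _), hexp]
    have hm : MemLp (fun t => |chordTau k a (descent k b) t| ^ (conjExp s - 1)) s
        (volume.restrict (Ioc 0 1)) := by
      rw [← integrable_norm_rpow_iff
        ((measurable_chordTau.abs.pow_const _).aestronglyMeasurable) hs0 hs]
      simp only [e2]
      exact (intervalIntegrable_iff_integrableOn_Ioc_of_le zero_le_one).1 h.integrable_energy
    rw [hm.eLpNorm_eq_integral_rpow_norm hs0 hs]
    simp only [e2]
    rw [energy, intervalIntegral.integral_of_le zero_le_one, one_div]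

theorem Extremal.memLp_tauPow (h : Extremal s k a b) : MemLp (tauPow s k a b) s vol :=
  ⟨h.integrable_tauPow.1.restrict, by rw [h.eLpNorm_tauPow]; exact ENNReal.ofReal_lt_top⟩

theorem Extremal.norm_tauPow (h : Extremal s k a b) :
    norm s (tauPow s k a b) = energy s k a b ^ (1 / s.toReal) := by
  rw [norm, h.eLpNorm_tauPow, ENNReal.toReal_ofReal (Real.rpow_nonneg h.energy_pos.le _)]

theorem Extremal.norm_d2 (h : Extremal s k a b) :
    norm s (d2 (phi s k a b)) = energy s k a b ^ (1 / s.toReal) := by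
  rw [← h.norm_tauPow, norm, eLpNorm_congr_ae h.d2_phi, norm]

theorem Extremal.triple (h : Extremal s k a b) :
    Triple s (phi s k a b 0) (energy s k a b ^ (1 / s.toReal)) (phi s k a b)
      (fun x => ∫ t in a..x, tauPow s k a b t) (tauPow s k a b) where
  bdd _ ht := h.abs_phi_le ht
  hasDeriv _ _ := (h.hasDerivAt_phi _).hasDerivWithinAt
  prim _ _ := (intervalIntegral.integral_add_adjacent_intervals (h.intervalIntegrable _ _)
    (h.intervalIntegrable _ _)).symm
  memLp := h.memLp_tauPow
  norm_le := h.norm_tauPow.le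

theorem Extremal.phi_mem_space (h : Extremal s k a b) : phi s k a b ∈ space s := by
  have hcont : Continuous (phi s k a b) :=
    continuous_iff_continuousAt.2 fun x => (h.hasDerivAt_phi x).continuousAt
  refine ⟨memLp_top_of_bound hcont.aestronglyMeasurable (phi s k a b 0) ?_,
    fun x _ => (h.hasDerivAt_phi x).differentiableAt.differentiableWithinAt,
    fun c hc => h.absolutelyContinuous_d1 hc, h.memLp_tauPow.ae_eq h.d2_phi.symm⟩
  rw [vol, ae_restrict_iff' measurableSet_Ici]
  exact Eventually.of_forall fun x hx => h.abs_phi_le hx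

/-- The extremal function turns the additive inequality into an equality. -/
theorem Extremal.representation_phi (h : Extremal s k a b) :
    k * (k - 1) * ∫ t in Ioi (0 : ℝ), (phi s k a b t - phi s k a b 0 -
      (∫ u in a..(0 : ℝ), tauPow s k a b u) * t) * t ^ (-1 - k) =
      2 * (1 + descent k b) / a * phi s k a b 0 + energy s k a b := by
  have hk := h.one_lt
  -- The values of `φ` at `0`, `a`, `1` and on `(1, ∞)` have the signs of their weights, so no
  -- cancellation occurs.
  rw [h.triple.representation h.one_lt_s hk h.lt h.mem_a.1 h.mem_a.2.le h.descent_nonneg,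
    h.integral_mul_tauPow, h.phi_knot, h.phi_one]
  have : ∫ t in Ioi (1 : ℝ), phi s k a b t * t ^ (-1 - k) = phi s k a b 0 * (1 / k) := by
    rw [← integral_Ioi_one_rpow (by linarith : 0 < k), ← integral_const_mul]
    refine setIntegral_congr_fun measurableSet_Ioi fun t ht => ?_
    rw [h.phi_of_ge (le_of_lt ht)]
  rw [this]
  have : k ≠ 0 := by linarith
  field_simp
  ring

end

/-! ### The Marchaud derivative on the space -/

section

variable {s : ℝ≥0∞} {k a b c : ℝ} {f : ℝ → ℝ}

/-- By continuity a violation at `x` persists on an interval to the right of `x`, which has positive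
measure. Working to the right includes `x = 0`. -/
theorem abs_le_norm_top {u : ℝ → ℝ} (hu : ContinuousOn u (Ici 0)) (hm : MemLp u ∞ vol) {x : ℝ}
    (hx : 0 ≤ x) : |u x| ≤ norm ∞ u := by
  by_contra! hlt
  have hae : ∀ᵐ y ∂vol, |u y| ≤ norm ∞ u := by
    filter_upwards [ae_le_eLpNormEssSup (f := u) (μ := vol)] with y hy
    rw [norm, eLpNorm_exponent_top, ← Real.norm_eq_abs, ← toReal_enorm]
    refine ENNReal.toReal_mono ?_ hy
    have := hm.2.ne
    rwa [eLpNorm_exponent_top] at this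
  have hev : ∀ᶠ y in 𝓝[Ici 0] x, norm ∞ u < |u y| :=
    (hu x hx).abs.eventually (lt_mem_nhds hlt)
  have hev' : ∀ᶠ y in 𝓝[>] x, norm ∞ u < |u y| :=
    hev.filter_mono (nhdsWithin_mono _ fun y (hy : x < y) => hx.trans hy.le)
  obtain ⟨z, hz, hzm⟩ := (mem_nhdsGT_iff_exists_Ioo_subset).1 hev'
  rw [vol, ae_restrict_iff' measurableSet_Ici, ae_iff] at hae
  have hle : volume (Ioo x z) ≤ 0 := by
    rw [← hae]
    refine measure_mono fun y hy => ?_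
    simp only [mem_ofPred_eq]
    intro hcon
    exact absurd (hcon (hx.trans hy.1.le)) (not_le.2 (hzm hy))
  rw [Real.volume_Ioo] at hle
  have hz : x < z := hz
  simp at hle
  linarith

theorem norm_top_le {u : ℝ → ℝ} {C : ℝ} (hC : 0 ≤ C) (hu : ∀ x, 0 ≤ x → |u x| ≤ C) :
    norm ∞ u ≤ C := by
  rw [norm, eLpNorm_exponent_top]
  refine ENNReal.toReal_le_of_le_ofReal hC (eLpNormEssSup_le_of_ae_bound ?_)
  rw [vol, ae_restrict_iff' measurableSet_Ici]
  exact Eventually.of_forall hu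

theorem norm_nonneg' (p : ℝ≥0∞) (u : ℝ → ℝ) : 0 ≤ norm p u := ENNReal.toReal_nonneg

theorem continuousOn_of_mem_space (hf : f ∈ space s) : ContinuousOn f (Ici 0) := hf.2.1.continuousOn

theorem map_affine_vol {x h : ℝ} (hh : 0 < h) :
    Measure.map (fun t => x + h * t) vol = ENNReal.ofReal h⁻¹ • volume.restrict (Ici x) := by
  have e : (fun t : ℝ => x + h * t) ⁻¹' Ici x = Ici 0 := by
    ext t
    simp [hh]
  have hm : Measure.map (fun t : ℝ => x + h * t) volume = ENNReal.ofReal h⁻¹ • volume := by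
    have : (fun t : ℝ => x + h * t) = (fun y => x + y) ∘ fun t => h * t := rfl
    rw [this, ← Measure.map_map (by fun_prop) (by fun_prop), Real.map_volume_mul_left hh.ne',
      Measure.map_smul, map_add_left_eq_self, abs_of_pos (inv_pos.2 hh)]
  rw [vol, ← e, ← Measure.restrict_map (by fun_prop) measurableSet_Ici, hm, Measure.restrict_smul]

/-- Change of variables; only an inequality, since the image is `[x, ∞)` rather than the whole
half-line. -/
theorem memLp_comp_affine {u : ℝ → ℝ} (hu : MemLp u s vol) {x h : ℝ} (hx : 0 ≤ x)
    (hh : 0 < h) : MemLp (fun t => u (x + h * t)) s vol ∧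
      norm s (fun t => u (x + h * t)) ≤ h ^ (-(1 / s.toReal)) * norm s u := by
  have hsub : volume.restrict (Ici x) ≤ vol :=
    Measure.restrict_mono (Ici_subset_Ici.2 hx) le_rfl
  have hmap := map_affine_vol (x := x) hh
  have hne : ENNReal.ofReal h⁻¹ ≠ 0 := by simpa using hh
  have hm1 : MemLp u s (Measure.map (fun t => x + h * t) vol) := by
    rw [hmap]
    exact (hu.mono_measure hsub).smul_measure ENNReal.ofReal_ne_top
  have hm2 : MemLp (fun t => u (x + h * t)) s vol :=
    hm1.comp_of_map (f := fun t => x + h * t) (by fun_prop)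
  refine ⟨hm2, ?_⟩
  have e : eLpNorm (fun t => u (x + h * t)) s vol =
      ENNReal.ofReal h⁻¹ ^ (1 / s).toReal • eLpNorm u s (volume.restrict (Ici x)) := by
    rw [← eLpNorm_smul_measure_of_ne_zero hne, ← hmap,
      eLpNorm_map_measure hm1.1 (by fun_prop)]
    rfl
  rw [norm, e, smul_eq_mul, ENNReal.toReal_mul]
  have e2 : (ENNReal.ofReal h⁻¹ ^ (1 / s).toReal).toReal = h ^ (-(1 / s.toReal)) := by
    rw [← ENNReal.toReal_rpow, ENNReal.toReal_ofReal (inv_nonneg.2 hh.le), Real.inv_rpow hh.le,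
      Real.rpow_neg hh.le]
    simp
  rw [e2]
  exact mul_le_mul_of_nonneg_left (ENNReal.toReal_mono hu.2.ne (eLpNorm_mono_measure u hsub))
    (Real.rpow_nonneg hh.le _)

theorem norm_const_mul (p : ℝ≥0∞) (c : ℝ) (u : ℝ → ℝ) :
    norm p (fun t => c * u t) = |c| * norm p u := by
  have : (fun t => c * u t) = c • u := rfl
  rw [norm, this, eLpNorm_const_smul, ENNReal.toReal_mul, norm]
  simp

theorem integral_d2 (hf : f ∈ space s) {x y : ℝ} (hx : 0 ≤ x) (hxy : x ≤ y) :
    ∫ t in x..y, d2 f t = d1 f y - d1 f x := by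
  have hac : AbsolutelyContinuousOnInterval (d1 f) x y :=
    (hf.2.2.1 (y + 1) (by linarith)).mono (by
      rw [uIcc_of_le hxy, uIcc_of_le (by linarith)]
      exact Icc_subset_Icc hx (by linarith))
  rw [← hac.integral_deriv_eq_sub]
  refine intervalIntegral.integral_congr_uIoo fun t ht => ?_
  rw [uIoo_of_le hxy] at ht
  exact derivWithin_of_mem_nhds (Ici_mem_nhds (hx.trans_lt ht.1))

/-- A member of the space, translated and dilated. -/
theorem triple_of_mem_space (hf : f ∈ space s) {x h : ℝ} (hx : 0 ≤ x) (hh : 0 < h) :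
    Triple s (norm ∞ f) (h ^ (2 - 1 / s.toReal) * norm s (d2 f)) (fun t => f (x + h * t))
      (fun t => h * d1 f (x + h * t)) (fun t => h ^ 2 * d2 f (x + h * t)) := by
  obtain ⟨hm, hn⟩ := memLp_comp_affine hf.2.2.2 hx hh
  have hpos : ∀ t, 0 ≤ t → 0 ≤ x + h * t := fun t ht => by positivity
  refine ⟨fun t ht => abs_le_norm_top (continuousOn_of_mem_space hf) hf.1 (hpos t ht),
    fun t ht => ?_, fun t ht => ?_, hm.const_mul _, ?_⟩
  · have h1 : HasDerivWithinAt f (d1 f (x + h * t)) (Ici 0) (x + h * t) :=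
      (hf.2.1 _ (hpos t ht)).hasDerivWithinAt
    have h2 : HasDerivWithinAt (fun t => x + h * t) h (Ici 0) t := by
      simpa using (((hasDerivAt_id t).const_mul h).const_add x).hasDerivWithinAt
    have := h1.comp t h2 fun u hu => hpos u hu
    rw [mul_comm] at this
    exact this
  · rw [intervalIntegral.integral_const_mul,
      intervalIntegral.integral_comp_add_mul (d2 f) hh.ne', mul_zero, add_zero,
      integral_d2 hf hx (by nlinarith), smul_eq_mul]
    field_simp
    ring
  · rw [norm_const_mul, abs_of_pos (by positivity)]
    calc h ^ 2 * norm s (fun t => d2 f (x + h * t))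
        ≤ h ^ 2 * (h ^ (-(1 / s.toReal)) * norm s (d2 f)) := by gcongr
      _ = _ := by
        rw [← mul_assoc, sub_eq_add_neg, Real.rpow_add hh, Real.rpow_two]

/-! ### The Marchaud derivative for `1 < k < 2` -/

theorem floor_eq_one (hk : 1 < k) (hk2 : k < 2) : ⌊k⌋₊ = 1 := by
  rw [Nat.floor_eq_iff (by linarith)]
  constructor <;> norm_num <;> linarith

theorem marchaudIntegrand_eq (hk : 1 < k) (hk2 : k < 2) (f : ℝ → ℝ) (x t : ℝ) :
    marchaudIntegrand k f x t = (f x - 2 * f (x + t) + f (x + 2 * t)) / t ^ (1 + k) := by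
  rw [marchaudIntegrand, floor_eq_one hk hk2, diff]
  congr 1
  simp [Finset.sum_range_succ]
  ring

theorem kappa_eq (hk : 1 < k) (hk2 : k < 2) :
    kappa k (⌊k⌋₊ + 1) = Real.Gamma (-k) * (2 ^ k - 2) := by
  rw [floor_eq_one hk hk2, kappa]
  congr 1
  simp [Finset.sum_range_succ, Real.zero_rpow (by linarith : k ≠ 0)]
  ring

theorem gamma_neg_ne_zero (hk : 1 < k) (hk2 : k < 2) : Real.Gamma (-k) ≠ 0 := by
  refine Real.Gamma_ne_zero fun m hm => ?_
  have hm' : k = m := by linarith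
  rw [hm'] at hk hk2
  have h1 : 1 < m := by exact_mod_cast hk
  have h2 : m < 2 := by exact_mod_cast hk2
  omega

theorem two_rpow_sub_two_pos (hk : 1 < k) : 0 < (2 : ℝ) ^ k - 2 := by
  have := Real.rpow_lt_rpow_of_exponent_lt one_lt_two hk
  rw [Real.rpow_one] at this
  linarith

theorem integrableOn_marchaudIntegrand (hs : 1 < s) (hk : 1 < k) (hks : k < 2 - 1 / s.toReal)
    (hf : f ∈ space s) {x : ℝ} (hx : 0 ≤ x) : IntegrableOn (marchaudIntegrand k f x) (Ioi 0) := by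
  have := ((triple_of_mem_space hf hx one_pos).second_difference hs hk hks).1
  refine this.congr_fun (fun t _ => ?_) measurableSet_Ioi
  simp only [marchaudIntegrand_eq hk (lt_two_of_lt hks), one_mul, mul_zero, add_zero]

/-- The Marchaud derivative through the Taylor remainder of a dilation. -/
theorem rpow_mul_marchaud (hs : 1 < s) (hk : 1 < k) (hks : k < 2 - 1 / s.toReal)
    (hf : f ∈ space s) {x h : ℝ} (hx : 0 ≤ x) (hh : 0 < h) :
    Real.Gamma (-k) * (h ^ k * marchaud k f x) =
      ∫ t in Ioi (0 : ℝ), (f (x + h * t) - f x - h * d1 f x * t) * t ^ (-1 - k) := by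
  have hk2 := lt_two_of_lt hks
  have e := ((triple_of_mem_space hf hx hh).second_difference hs hk hks).2
  simp only [mul_zero, add_zero] at e
  have e2 : ∫ t in Ioi (0 : ℝ), (f x - 2 * f (x + h * t) + f (x + h * (2 * t))) / t ^ (1 + k) =
      h ^ k * ∫ t in Ioi (0 : ℝ), marchaudIntegrand k f x t := by
    have e3 : EqOn (fun t => (f x - 2 * f (x + h * t) + f (x + h * (2 * t))) / t ^ (1 + k))
        (fun t => h ^ (1 + k) * marchaudIntegrand k f x (h * t)) (Ioi 0) := by
      intro t ht
      have ht : 0 < t := ht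
      simp only [marchaudIntegrand_eq hk hk2]
      rw [Real.mul_rpow hh.le ht.le, show h * (2 * t) = 2 * (h * t) by ring]
      have h1 : h ^ (1 + k) ≠ 0 := by positivity
      have h2 : t ^ (1 + k) ≠ 0 := by positivity
      field_simp
    rw [setIntegral_congr_fun measurableSet_Ioi e3, integral_const_mul,
      integral_comp_mul_left_Ioi _ _ hh, mul_zero, smul_eq_mul, ← mul_assoc, Real.rpow_add hh,
      Real.rpow_one]
    field_simp
  rw [e2] at e
  have hG := gamma_neg_ne_zero hk hk2
  have h2k := (two_rpow_sub_two_pos hk).ne'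
  rw [marchaud, kappa_eq hk hk2, mul_left_comm (h ^ k), e]
  have key : ∀ J : ℝ, Real.Gamma (-k) *
      (1 / (Real.Gamma (-k) * (2 ^ k - 2)) * ((2 ^ k - 2) * J)) = J := by
    intro J; field_simp
  exact key _

/-- The additive inequality for members of the space. -/
theorem Extremal.marchaud_le (hE : Extremal s k a b) (hf : f ∈ space s) {x h : ℝ} (hx : 0 ≤ x)
    (hh : 0 < h) :
    k * (k - 1) * |Real.Gamma (-k)| * (h ^ k * |marchaud k f x|) ≤
      2 * (1 + descent k b) / a * norm ∞ f + energy s k a b ^ (1 - 1 / s.toReal) *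
        (h ^ (2 - 1 / s.toReal) * norm s (d2 f)) := by
  have h1 := (triple_of_mem_space hf hx hh).additive_inequality hE.one_lt_s hE.one_lt hE.lt
    hE.mem_a.1 hE.mem_a.2.le (descent_ge hE.one_lt ⟨hE.mem_b.1, hE.mem_b.2.le⟩)
  simp only [mul_zero, add_zero] at h1
  rw [← rpow_mul_marchaud hE.one_lt_s hE.one_lt hE.lt hf hx hh, abs_mul, abs_mul,
    abs_of_pos (Real.rpow_pos_of_pos hh k), ← mul_assoc] at h1
  exact h1

theorem Extremal.marchaud_phi (hE : Extremal s k a b) :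
    k * (k - 1) * |Real.Gamma (-k)| * |marchaud k (phi s k a b) 0| =
      2 * (1 + descent k b) / a * phi s k a b 0 + energy s k a b := by
  have h1 := rpow_mul_marchaud hE.one_lt_s hE.one_lt hE.lt hE.phi_mem_space le_rfl one_pos
  simp only [zero_add, one_mul, Real.one_rpow, hE.d1_phi le_rfl] at h1
  have h2 := hE.representation_phi
  rw [← h1] at h2
  have hkk : 0 < k * (k - 1) := mul_pos (by linarith [hE.one_lt]) (by linarith [hE.one_lt])
  have hpos : 0 ≤ 2 * (1 + descent k b) / a * phi s k a b 0 + energy s k a b := by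
    have := hE.mem_a.1
    have := hE.descent_nonneg
    have := hE.phi_zero_pos
    have := hE.energy_pos
    positivity
  rw [← abs_of_nonneg hpos, ← h2, abs_mul (k * (k - 1)), abs_mul (Real.Gamma _), abs_of_pos hkk,
    mul_assoc (k * (k - 1))]

/-- Dominated convergence with a majorant independent of `x`: `O(t^(2 - 1/s))` near 0 from two
Taylor remainders, `4N` at infinity. Continuity gives measurability and bounds the value at 0 by the
essential supremum. -/
theorem continuousOn_marchaud (hs : 1 < s) (hk : 1 < k) (hks : k < 2 - 1 / s.toReal)
    (hf : f ∈ space s) : ContinuousOn (marchaud k f) (Ici 0) := by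
  have hk2 := lt_two_of_lt hks
  have hc := continuousOn_of_mem_space hf
  set S := norm s (d2 f) with hS
  set N := norm ∞ f with hN
  have hS0 : 0 ≤ S := norm_nonneg' _ _
  set μ := 2 - 1 / s.toReal with hμ
  set C := S * 2 ^ μ + 2 * S with hC
  set B : ℝ → ℝ := fun t => if t ≤ 1 then C * t ^ (μ + (-1 - k)) else 4 * N * t ^ (-1 - k) with hB
  have hBi : IntegrableOn B (Ioi 0) := by
    rw [← Ioc_union_Ioi_eq_Ioi (zero_le_one' ℝ)]
    refine IntegrableOn.union ?_ ?_
    · have hi := (intervalIntegral.intervalIntegrable_rpow' (a := 0) (b := 1)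
        (by linarith : -1 < μ + (-1 - k))).const_mul C
      rw [intervalIntegrable_iff_integrableOn_Ioc_of_le zero_le_one] at hi
      refine IntegrableOn.congr_fun hi (fun t ht => ?_) measurableSet_Ioc
      simp only [hB]
      rw [if_pos ht.2]
    · have hi := (integrableOn_Ioi_rpow_of_lt (a := -1 - k) (by linarith) one_pos).const_mul (4 * N)
      refine IntegrableOn.congr_fun hi (fun t ht => ?_) measurableSet_Ioi
      simp only [hB]
      rw [if_neg (not_le.2 ht)]
  have hle : ∀ x ∈ Ici (0 : ℝ), ∀ t ∈ Ioi (0 : ℝ), ‖marchaudIntegrand k f x t‖ ≤ B t := by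
    intro x hx t ht
    have ht : 0 < t := ht
    have hx : 0 ≤ x := hx
    have hT := triple_of_mem_space hf hx one_pos
    have hp : t ^ (-1 - k) = (t ^ (1 + k))⁻¹ := by
      rw [← Real.rpow_neg ht.le]; congr 1; ring
    rw [marchaudIntegrand_eq hk hk2, div_eq_mul_inv, ← hp, norm_mul,
      Real.norm_of_nonneg (Real.rpow_nonneg ht.le (-1 - k)), Real.norm_eq_abs]
    simp only [hB]
    split_ifs with h1
    · rw [Real.rpow_add ht, ← mul_assoc]
      refine mul_le_mul_of_nonneg_right ?_ (Real.rpow_nonneg ht.le _)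
      have r1 := hT.abs_remainder_le hs (t := t) ht.le
      have r2 := hT.abs_remainder_le hs (t := 2 * t) (by linarith)
      simp only [one_mul, mul_zero, add_zero, Real.one_rpow] at r1 r2
      rw [Real.mul_rpow two_pos.le ht.le] at r2
      have e : f x - 2 * f (x + t) + f (x + 2 * t) = (f (x + 2 * t) - f x - d1 f x * (2 * t)) -
          2 * (f (x + t) - f x - d1 f x * t) := by ring
      rw [e]
      refine (abs_sub _ _).trans ?_
      rw [abs_mul, abs_two]
      have : C * t ^ μ = S * (2 ^ μ * t ^ μ) + 2 * (S * t ^ μ) := by rw [hC]; ring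
      rw [this]
      linarith
    · refine mul_le_mul_of_nonneg_right ?_ (Real.rpow_nonneg ht.le _)
      have b0 := abs_le.1 (abs_le_norm_top hc hf.1 hx)
      have b1 := abs_le.1 (abs_le_norm_top hc hf.1 (by linarith : 0 ≤ x + t))
      have b2 := abs_le.1 (abs_le_norm_top hc hf.1 (by linarith : 0 ≤ x + 2 * t))
      rw [abs_le]
      constructor <;> linarith
  refine continuousOn_const.mul (continuousOn_of_dominated (bound := B)
    (fun x hx => (integrableOn_marchaudIntegrand hs hk hks hf hx).1)
    (fun x hx => (ae_restrict_iff' measurableSet_Ioi).2 (Eventually.of_forall (hle x hx))) hBi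
    ((ae_restrict_iff' measurableSet_Ioi).2 (Eventually.of_forall fun t ht => ?_)))
  have ht : 0 < t := ht
  simp only [marchaudIntegrand_eq hk hk2]
  have hshift : ∀ u : ℝ, 0 ≤ u → ContinuousOn (fun x => f (x + u)) (Ici 0) := fun u hu =>
    hc.comp (by fun_prop) fun x (hx : 0 ≤ x) => (add_nonneg hx hu : (0 : ℝ) ≤ x + u)
  exact ((hc.sub ((hshift t ht.le).const_smul (2 : ℝ))).add (hshift (2 * t) (by linarith))).div_const _

theorem memLp_marchaud (hE : Extremal s k a b) (hf : f ∈ space s) :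
    MemLp (marchaud k f) ∞ vol := by
  have hc := continuousOn_marchaud hE.one_lt_s hE.one_lt hE.lt hf
  have hG := abs_pos.2 (gamma_neg_ne_zero hE.one_lt hE.lt_two)
  have hkk : 0 < k * (k - 1) := mul_pos (by linarith [hE.one_lt]) (by linarith [hE.one_lt])
  refine memLp_top_of_bound (hc.aestronglyMeasurable measurableSet_Ici)
    ((2 * (1 + descent k b) / a * norm ∞ f + energy s k a b ^ (1 - 1 / s.toReal) * norm s (d2 f)) /
      (k * (k - 1) * |Real.Gamma (-k)|)) ?_
  rw [vol, ae_restrict_iff' measurableSet_Ici]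
  refine Eventually.of_forall fun x hx => ?_
  have := hE.marchaud_le hf hx one_pos
  simp only [Real.one_rpow, one_mul] at this
  rw [le_div_iff₀ (mul_pos hkk hG), mul_comm]
  exact this

end

/-! ### The sharp multiplicative inequality -/

section

variable {s : ℝ≥0∞} {k a b c : ℝ} {f : ℝ → ℝ}

/-- From a family of additive inequalities with a dilation parameter to the multiplicative one. -/
theorem multiplicative_of_additive {κ V Q D D₀ N N₀ S k μ : ℝ} (hκ : 0 < κ)
    (hD₀ : V * N₀ + Q ≤ κ * D₀) (hN₀ : 0 < N₀) (hN : 0 ≤ N) (hS : 0 ≤ S) (hk : 0 < k) (hkμ : k < μ)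
    (h : ∀ r, 0 < r → κ * (r ^ k * D) ≤ V * N + Q * (r ^ μ * S)) :
    D ≤ D₀ / N₀ ^ (1 - k / μ) * N ^ (1 - k / μ) * S ^ (k / μ) := by
  have hμ : 0 < μ := hk.trans hkμ
  have hlam : 0 < k / μ := div_pos hk hμ
  have hlam1 : 0 < 1 - k / μ := by rw [sub_pos, div_lt_one hμ]; exact hkμ
  have h' : ∀ r, 0 < r → κ * D ≤ V * N * r ^ (-k) + Q * S * r ^ (μ - k) := by
    intro r hr
    have e1 : r ^ (-k) * r ^ k = 1 := by rw [← Real.rpow_add hr]; simp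
    have e2 : r ^ (μ - k) = r ^ (-k) * r ^ μ := by rw [← Real.rpow_add hr]; congr 1; ring
    have := mul_le_mul_of_nonneg_left (h r hr) (Real.rpow_nonneg hr.le (-k))
    calc κ * D = r ^ (-k) * (κ * (r ^ k * D)) := by
          rw [show r ^ (-k) * (κ * (r ^ k * D)) = r ^ (-k) * r ^ k * (κ * D) by ring, e1, one_mul]
      _ ≤ _ := this
      _ = _ := by rw [e2]; ring
  -- If `S = 0` or `N = 0` no optimal `r` exists; one lets `r → ∞` or `r → 0` instead.
  rcases hS.eq_or_lt with rfl | hS0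
  · rw [Real.zero_rpow hlam.ne', mul_zero]
    have hlim : Tendsto (fun r : ℝ => V * N * r ^ (-k)) atTop (𝓝 0) := by
      simpa using (tendsto_rpow_neg_atTop hk).const_mul (V * N)
    have : κ * D ≤ 0 := ge_of_tendsto hlim (by
      filter_upwards [eventually_gt_atTop 0] with r hr
      simpa using h' r hr)
    nlinarith
  rcases hN.eq_or_lt with rfl | hN0
  · rw [Real.zero_rpow hlam1.ne', mul_zero, zero_mul]
    have hlim : Tendsto (fun r : ℝ => Q * S * r ^ (μ - k)) (𝓝[>] 0) (𝓝 0) := by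
      have := ((Real.continuousAt_rpow_const 0 (μ - k) (Or.inr (by linarith))).tendsto).const_mul (Q * S)
      rw [Real.zero_rpow (by linarith), mul_zero] at this
      exact this.mono_left nhdsWithin_le_nhds
    have : κ * D ≤ 0 := ge_of_tendsto hlim (by
      filter_upwards [self_mem_nhdsWithin] with r hr
      simpa using h' r hr)
    nlinarith
  -- The dilation `r = q^(1/μ)` makes `N : r^μ S` equal to `N₀ : 1`, so the right-hand side becomes
  -- `N / N₀` times the extremal value `V * N₀ + Q`.
  · set q := N / (N₀ * S) with hq
    have hq0 : 0 < q := by positivity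
    have key := h (q ^ (1 / μ)) (Real.rpow_pos_of_pos hq0 _)
    rw [← Real.rpow_mul hq0.le, ← Real.rpow_mul hq0.le, one_div_mul_cancel hμ.ne', Real.rpow_one,
      one_div_mul_eq_div] at key
    have e1 : V * N + Q * (q * S) = N / N₀ * (V * N₀ + Q) := by rw [hq]; field_simp
    have e2 : N / N₀ * (V * N₀ + Q) ≤ N / N₀ * (κ * D₀) := by gcongr
    have hql : 0 < q ^ (k / μ) := Real.rpow_pos_of_pos hq0 _
    have e3 : q ^ (k / μ) * D ≤ N / N₀ * D₀ := by
      rw [e1] at key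
      have := key.trans e2
      have h4 : κ * (q ^ (k / μ) * D) ≤ κ * (N / N₀ * D₀) := by linarith
      exact le_of_mul_le_mul_left h4 hκ
    rw [mul_comm, ← le_div_iff₀ hql] at e3
    refine e3.trans (le_of_eq ?_)
    rw [hq, Real.div_rpow hN (by positivity), Real.mul_rpow hN₀.le hS, Real.rpow_sub hN0,
      Real.rpow_sub hN₀, Real.rpow_one, Real.rpow_one]
    field_simp

/-! ### Homogeneity and the normalised extremal function -/

theorem d1_const_mul (c : ℝ) (f : ℝ → ℝ) : d1 (fun x => c * f x) = fun x => c * d1 f x := by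
  ext x; exact derivWithin_const_mul_field c

theorem d2_const_mul (c : ℝ) (f : ℝ → ℝ) : d2 (fun x => c * f x) = fun x => c * d2 f x := by
  ext x
  rw [d2, d1_const_mul]
  exact derivWithin_const_mul_field c

theorem const_mul_mem_space (hf : f ∈ space s) (c : ℝ) : (fun x => c * f x) ∈ space s := by
  refine ⟨hf.1.const_mul c, hf.2.1.const_mul c, fun r hr => ?_, ?_⟩
  · rw [d1_const_mul]; exact (hf.2.2.1 r hr).const_mul c
  · rw [d2_const_mul]; exact hf.2.2.2.const_mul c

theorem marchaud_const_mul (c : ℝ) (f : ℝ → ℝ) :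
    marchaud k (fun x => c * f x) = fun x => c * marchaud k f x := by
  ext x
  have : marchaudIntegrand k (fun x => c * f x) x = fun t => c * marchaudIntegrand k f x t := by
    ext t
    rw [marchaudIntegrand, marchaudIntegrand, diff, diff, mul_div_assoc', Finset.mul_sum]
    congr 1
    refine Finset.sum_congr rfl fun m _ => ?_
    ring
  rw [marchaud, this, integral_const_mul, marchaud]
  ring

theorem Extremal.norm_phi (hE : Extremal s k a b) : norm ∞ (phi s k a b) = phi s k a b 0 := by
  refine le_antisymm (norm_top_le hE.phi_zero_pos.le fun x hx => hE.abs_phi_le hx) ?_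
  exact (le_abs_self _).trans
    (abs_le_norm_top (continuousOn_of_mem_space hE.phi_mem_space) hE.phi_mem_space.1 le_rfl)

theorem Extremal.norm_d2_pos (hE : Extremal s k a b) : 0 < norm s (d2 (phi s k a b)) := by
  rw [hE.norm_d2]; exact Real.rpow_pos_of_pos hE.energy_pos _

theorem Extremal.Phi_mem_space (hE : Extremal s k a b) : Phi s k a b ∈ space s :=
  const_mul_mem_space hE.phi_mem_space _

theorem Extremal.norm_d2_Phi (hE : Extremal s k a b) : norm s (d2 (Phi s k a b)) = 1 := by
  have h := hE.norm_d2_pos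
  have : Phi s k a b = fun x => (norm s (d2 (phi s k a b)))⁻¹ * phi s k a b x := rfl
  rw [this, d2_const_mul, norm_const_mul, abs_of_pos (inv_pos.2 h), inv_mul_cancel₀ h.ne']

theorem Extremal.norm_Phi (hE : Extremal s k a b) :
    norm ∞ (Phi s k a b) = (norm s (d2 (phi s k a b)))⁻¹ * phi s k a b 0 := by
  have : Phi s k a b = fun x => (norm s (d2 (phi s k a b)))⁻¹ * phi s k a b x := rfl
  rw [this, norm_const_mul, abs_of_pos (inv_pos.2 hE.norm_d2_pos), hE.norm_phi]

theorem Extremal.norm_Phi_pos (hE : Extremal s k a b) : 0 < norm ∞ (Phi s k a b) := by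
  rw [hE.norm_Phi]
  exact mul_pos (inv_pos.2 hE.norm_d2_pos) hE.phi_zero_pos

/-- The equality for `φ` at `x = 0`, divided by the norm `energy^(1/s)` of `φ''`; this turns
`energy` into `energy^(1 - 1/s)`, the Hölder constant of the additive inequality. -/
theorem Extremal.le_norm_marchaud_Phi (hE : Extremal s k a b) :
    2 * (1 + descent k b) / a * norm ∞ (Phi s k a b) + energy s k a b ^ (1 - 1 / s.toReal) ≤
      k * (k - 1) * |Real.Gamma (-k)| * norm ∞ (marchaud k (Phi s k a b)) := by
  have hS := hE.norm_d2_pos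
  have hkk : 0 < k * (k - 1) := mul_pos (by linarith [hE.one_lt]) (by linarith [hE.one_lt])
  have e : Phi s k a b = fun x => (norm s (d2 (phi s k a b)))⁻¹ * phi s k a b x := rfl
  have h1 : |marchaud k (Phi s k a b) 0| ≤ norm ∞ (marchaud k (Phi s k a b)) :=
    abs_le_norm_top (continuousOn_marchaud hE.one_lt_s hE.one_lt hE.lt hE.Phi_mem_space)
      (memLp_marchaud hE hE.Phi_mem_space) le_rfl
  have h2 : |marchaud k (Phi s k a b) 0| =
      (norm s (d2 (phi s k a b)))⁻¹ * |marchaud k (phi s k a b) 0| := by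
    rw [e, marchaud_const_mul, abs_mul, abs_of_pos (inv_pos.2 hS)]
  have h3 : energy s k a b ^ (1 - 1 / s.toReal) =
      (norm s (d2 (phi s k a b)))⁻¹ * energy s k a b := by
    rw [hE.norm_d2, Real.rpow_sub hE.energy_pos, Real.rpow_one]
    field_simp
  calc _ = (norm s (d2 (phi s k a b)))⁻¹ *
        (2 * (1 + descent k b) / a * phi s k a b 0 + energy s k a b) := by
        rw [hE.norm_Phi, h3]; ring
    _ = k * (k - 1) * |Real.Gamma (-k)| * |marchaud k (Phi s k a b) 0| := by
        rw [← hE.marchaud_phi, h2]; ring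
    _ ≤ _ := by gcongr

theorem Extremal.multiplicative_inequality (hE : Extremal s k a b) (hf : f ∈ space s) :
    norm ∞ (marchaud k f) ≤
      norm ∞ (marchaud k (Phi s k a b)) / norm ∞ (Phi s k a b) ^ (1 - k / (2 - 1 / s.toReal)) *
        norm ∞ f ^ (1 - k / (2 - 1 / s.toReal)) * norm s (d2 f) ^ (k / (2 - 1 / s.toReal)) := by
  have hG := abs_pos.2 (gamma_neg_ne_zero hE.one_lt hE.lt_two)
  have hkk : 0 < k * (k - 1) := mul_pos (by linarith [hE.one_lt]) (by linarith [hE.one_lt])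
  refine norm_top_le ?_ fun x hx => multiplicative_of_additive (mul_pos hkk hG)
    hE.le_norm_marchaud_Phi hE.norm_Phi_pos (norm_nonneg' _ _) (norm_nonneg' _ _)
    (by linarith [hE.one_lt]) hE.lt fun r hr => hE.marchaud_le hf hx hr
  exact mul_nonneg (mul_nonneg (div_nonneg (norm_nonneg' _ _)
    (Real.rpow_nonneg (norm_nonneg' _ _) _)) (Real.rpow_nonneg (norm_nonneg' _ _) _))
    (Real.rpow_nonneg (norm_nonneg' _ _) _)

end

end HalfLine

theorem mainTheorem9 (s : ℝ≥0∞) (hs : 1 < s) (k : ℝ) (hk : 1 < k)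
    (hks : k < 2 - 1 / s.toReal) :
    (∃! p : ℝ × ℝ, HalfLine.IsSolution s k p) ∧
    (∀ f ∈ HalfLine.space s,
      (∀ x : ℝ, 0 ≤ x → IntegrableOn (HalfLine.marchaudIntegrand k f x) (Ioi 0)) ∧
      MemLp (HalfLine.marchaud k f) ∞ HalfLine.vol) ∧
    ∀ a b lam : ℝ, HalfLine.IsSolution s k (a, b) → lam = k / (2 - 1 / s.toReal) →
      HalfLine.Phi s k a b ∈ HalfLine.space s ∧
      HalfLine.norm s (HalfLine.d2 (HalfLine.Phi s k a b)) = 1 ∧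
      0 < HalfLine.norm ∞ (HalfLine.Phi s k a b) ∧
      IsLeast
        {K : ℝ | ∀ f ∈ HalfLine.space s,
          HalfLine.norm ∞ (HalfLine.marchaud k f) ≤
            K * HalfLine.norm ∞ f ^ (1 - lam) * HalfLine.norm s (HalfLine.d2 f) ^ lam}
        (HalfLine.norm ∞ (HalfLine.marchaud k (HalfLine.Phi s k a b)) /
          HalfLine.norm ∞ (HalfLine.Phi s k a b) ^ (1 - lam)) := by
  obtain ⟨q, hq, hq'⟩ := HalfLine.existsUnique_isSolution hs hk hks
  refine ⟨⟨q, hq, hq'⟩, fun f hf => ⟨fun x hx =>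
    HalfLine.integrableOn_marchaudIntegrand hs hk hks hf hx,
    HalfLine.memLp_marchaud (HalfLine.Extremal.of_isSolution (a := q.1) (b := q.2) hs hk hks hq) hf⟩, ?_⟩
  rintro a b lam hab rfl
  have hE := HalfLine.Extremal.of_isSolution hs hk hks hab
  refine ⟨hE.Phi_mem_space, hE.norm_d2_Phi, hE.norm_Phi_pos,
    fun f hf => hE.multiplicative_inequality hf, fun K hK => ?_⟩
  -- Leastness: any valid constant is tested on `Φ`, whose second derivative has norm 1.
  have h := hK _ hE.Phi_mem_space
  rw [hE.norm_d2_Phi, Real.one_rpow, mul_one] at h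
  rwa [div_le_iff₀ (Real.rpow_pos_of_pos hE.norm_Phi_pos _)]
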